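/- **Theorem.** The dual parameterized intersection problem for a matroid family and a greedoid family given by uniform polynomial-time oracles is $W[P]$-hard. In detail: a set system $(S,F)$ ($S$ finite, $F$ a collection of subsets of $S$) is a greedoid if (M1) $\emptyset\in F$ and (M3) whenever $X,Y\in F$ and $|X|>|Y|$ there is $x\in X\setminus Y$ with $Y\cup\{x\}\in F$; it is a matroid if moreover (M2) $Y\subseteq X\in F$ implies $Y\in F$. A family $\{(S_h,F_h)\}_{h\in H}$ of set systems, whose indices $h\in H$ are given by binary codes, is given by a uniform polynomial-time oracle if one algorithm decides, given $h$ and $X\subseteq S_h$, whether $X\in F_h$, in time polynomial in $|S_h|$. A parameterized problem $L$ (a set of pairs $(e,k)$, $e$ an instance coded as a binary string, $k\in\mathbb N$) reduces to a parameterized problem $L'$ if there are functions $f,g:\mathbb N\to\mathbb N$, a constant $c$ and a function $(e,k)\mapsto e'$ such that $(e',f(k))$ is computable from $(e,k)$ in time $g(k)\,(|e|+1)^c$, and $(e,k)\in L$ if and only if $(e',f(k))\in L'$. The class $W[P]$ consists of the parameterized languages $L\subseteq\{0,1\}^*\times\mathbb N$ that reduce to parameterized weighted circuit satisfiability: given a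 boolean circuit and $k\in\mathbb N$, is there a satisfying truth assignment with exactly $k$ variables set to true? A parameterized problem is $W[P]$-hard if every language in $W[P]$ reduces to it. Then there exist an index set $H$, domains $S_h$ ($h\in H$) computable from $h$ in time polynomial in $|h|$ (so that $|S_h|$ is polynomial in $|h|$), a family $\{(S_h,F_h)\}_{h\in H}$ of matroids and a family $\{(S_h,G_h)\}_{h\in H}$ of greedoids, both given by uniform polynomial-time oracles, such that the following parameterized problem is $W[P]$-hard: given $h\in H$ and a parameter $k\in\mathbb N$, decide whether there is a set $X\in F_h\cap G_h$ with $|X|=|S_h|-k$. -/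

import Mathlib

/-! ### Time-bounded computation (on Mathlib's multi-stack Turing machines) -/

/-- One Turing machine computes `f` (on codes), and on every input `a` it halts after at most `T a`
steps. The bound may depend on the input itself and not only on the length of its code. -/
def ComputableWithin {α β Γ₀ Γ₁ : Type} (ea : α → List Γ₀) (eb : β → List Γ₁) (f : α → β)
    (T : α → ℕ) : Prop :=
  ∃ M : Turing.TM2ComputableAux Γ₀ Γ₁, ∀ a : α,
    Nonempty (Turing.TM2OutputsInTime M.tm ((ea a).map M.inputAlphabet.invFun)
      (some ((eb (f a)).map M.outputAlphabet.invFun)) (T a))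

/-! ### Parameterized problems and reductions -/

/-- A parameterized decision problem: instances `e` with an injective binary code, a parameter
`k : ℕ`, and the set of yes-instances `(e, k)`. -/
structure ParamProblem where
  Inst : Type
  code : Inst → List Bool
  code_injective : Function.Injective code
  yes : Set (Inst × ℕ)

/-- A parameterized language `L ⊆ {0,1}* × ℕ`. -/
def ParamProblem.ofLanguage (L : Set (List Bool × ℕ)) : ParamProblem where
  Inst := List Bool
  code := id
  code_injective := Function.injective_id
  yes := L

/-- The string given to (or produced by) a machine for the pair `(e, k)`: the code of `e`, followed
by `k` copies of a separate marker symbol. -/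
def ParamProblem.pairCode (P : ParamProblem) (p : P.Inst × ℕ) : List (Option Bool) :=
  (P.code p.1).map some ++ List.replicate p.2 none

/-- Standard parameterized many-one reductions: `(e, k) ↦ (r (e, k), f k)` preserves and reflects
membership and is computable in time `g k * |e| ^ c`, with `g` an arbitrary function. (The base
`|e| + 1` keeps the bound meaningful for the empty string.) -/
def ParamProblem.ReducesTo (P Q : ParamProblem) : Prop :=
  ∃ (f g : ℕ → ℕ) (c : ℕ) (r : P.Inst × ℕ → Q.Inst),
    ComputableWithin P.pairCode Q.pairCode (fun p => (r p, f p.2))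
      (fun p => g p.2 * ((P.code p.1).length + 1) ^ c) ∧
    ∀ (e : P.Inst) (k : ℕ), (e, k) ∈ P.yes ↔ (r (e, k), f k) ∈ Q.yes

/-! ### Boolean circuits and the class `W[P]` -/

/-- The unary code of a natural number, self-delimiting. -/
def unaryCode (i : ℕ) : List Bool := List.replicate i true ++ [false]

/-- A gate; the arguments are the numbers of the wires that it reads. -/
inductive Gate where
  | not (i : ℕ)
  | and (i j : ℕ)
  | or (i j : ℕ)

namespace Gate

def args : Gate → List ℕ
  | not i => [i]
  | and i j => [i, j]
  | or i j => [i, j]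

/-- The value of a gate, given the list of the values of the wires. -/
def eval (w : List Bool) : Gate → Bool
  | not i => !(w.getD i false)
  | and i j => w.getD i false && w.getD j false
  | or i j => w.getD i false || w.getD j false

def code : Gate → List Bool
  | not i => false :: false :: unaryCode i
  | and i j => false :: true :: (unaryCode i ++ unaryCode j)
  | or i j => true :: (unaryCode i ++ unaryCode j)

end Gate

/-- A boolean circuit with `numVars` variables. The wires `0, …, numVars - 1` carry the variables,
wire `numVars + i` carries the value of gate `i`; the gates are listed in topological order, and
`out` is the output wire. -/
@[ext] structure Circuit where
  numVars : ℕ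
  gates : List Gate
  out : ℕ
  args_lt : ∀ (i : ℕ) (hi : i < gates.length), ∀ j ∈ gates[i].args, j < numVars + i
  out_lt : out < numVars + gates.length

namespace Circuit

/-- The values of all the wires under the assignment `x`. -/
def wires (C : Circuit) (x : Fin C.numVars → Bool) : List Bool :=
  C.gates.foldl (fun w g => w ++ [g.eval w]) (List.ofFn x)

def eval (C : Circuit) (x : Fin C.numVars → Bool) : Bool :=
  (C.wires x).getD C.out false

def gatesCode (l : List Gate) : List Bool :=
  l.flatMap (fun g => true :: g.code) ++ [false]

def code (C : Circuit) : List Bool :=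
  unaryCode C.numVars ++ (unaryCode C.out ++ gatesCode C.gates)

end Circuit

theorem unaryCode_append_inj {i j : ℕ} {s t : List Bool}
    (h : unaryCode i ++ s = unaryCode j ++ t) : i = j ∧ s = t := by
  induction i generalizing j with
  | zero => cases j <;> simp_all [unaryCode, List.replicate_succ]
  | succ i ih =>
    cases j with
    | zero => simp [unaryCode, List.replicate_succ] at h
    | succ j =>
      have h2 : unaryCode i ++ s = unaryCode j ++ t := by
        simpa [unaryCode, List.replicate_succ] using h
      obtain ⟨h3, h4⟩ := ih h2
      exact ⟨by rw [h3], h4⟩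

theorem Gate.code_append_inj {a b : Gate} {s t : List Bool}
    (h : a.code ++ s = b.code ++ t) : a = b ∧ s = t := by
  cases a <;> cases b <;>
    simp only [Gate.code, List.cons_append, List.append_assoc, List.cons.injEq, true_and,
      reduceCtorEq, false_and] at h
  · obtain ⟨h1, h2⟩ := unaryCode_append_inj h
    exact ⟨by rw [h1], h2⟩
  all_goals
    obtain ⟨h1, h2⟩ := unaryCode_append_inj h
    obtain ⟨h3, h4⟩ := unaryCode_append_inj h2
    exact ⟨by rw [h1, h3], h4⟩

theorem Circuit.gatesCode_injective : Function.Injective Circuit.gatesCode := by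
  intro l m h
  induction l generalizing m with
  | nil => cases m <;> simp_all [Circuit.gatesCode]
  | cons a l ih =>
    cases m with
    | nil => simp [Circuit.gatesCode] at h
    | cons b m =>
      have h2 : a.code ++ Circuit.gatesCode l = b.code ++ Circuit.gatesCode m := by
        simpa [Circuit.gatesCode] using h
      obtain ⟨rfl, h3⟩ := Gate.code_append_inj h2
      rw [ih h3]

theorem Circuit.code_injective : Function.Injective Circuit.code := by
  intro C D h
  obtain ⟨h1, h⟩ := unaryCode_append_inj h
  obtain ⟨h2, h⟩ := unaryCode_append_inj h
  exact Circuit.ext h1 (Circuit.gatesCode_injective h) h2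

/-- Parameterized weighted circuit satisfiability: does the circuit have a satisfying truth
assignment with exactly `k` variables set to true? -/
def weightedCircuitSat : ParamProblem where
  Inst := Circuit
  code := Circuit.code
  code_injective := Circuit.code_injective
  yes := {p | ∃ x : Fin p.1.numVars → Bool,
    (Finset.univ.filter (fun i => x i = true)).card = p.2 ∧ p.1.eval x = true}

/-- The class `W[P]`: the parameterized languages that reduce to parameterized weighted circuit
satisfiability. -/
def WP : Set (Set (List Bool × ℕ)) :=
  {L | (ParamProblem.ofLanguage L).ReducesTo weightedCircuitSat}

/-- `Q` is `W[P]`-hard: every language in `W[P]` reduces to `Q`. -/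
def WPHard (Q : ParamProblem) : Prop :=
  ∀ L ∈ WP, (ParamProblem.ofLanguage L).ReducesTo Q

/-! ### Matroid and greedoid families given by uniform polynomial-time oracles -/

/-- A set system on the domain `Fin n` is a greedoid: (M1) and (M3). -/
def IsGreedoid {n : ℕ} (F : Set (Finset (Fin n))) : Prop :=
  ∅ ∈ F ∧ ∀ X ∈ F, ∀ Y ∈ F, Y.card < X.card → ∃ x ∈ X \ Y, insert x Y ∈ F

/-- A set system on the domain `Fin n` is a matroid: (M1), (M2) and (M3). -/
def IsMatroid {n : ℕ} (F : Set (Finset (Fin n))) : Prop :=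
  ∅ ∈ F ∧ (∀ X ∈ F, ∀ Y ⊆ X, Y ∈ F) ∧
    ∀ X ∈ F, ∀ Y ∈ F, Y.card < X.card → ∃ x ∈ X \ Y, insert x Y ∈ F

/-- A set `H` of indices, given with binary codes, and for every index `h` the domain
`S_h = {0, …, size h - 1}`. -/
structure IndexedDomains where
  H : Type
  code : H → List Bool
  code_injective : Function.Injective code
  size : H → ℕ

/-- The domain `S_h` (as a unary number) is computable from `h` in time polynomial in `|h|`;
in particular `|S_h|` is polynomially bounded in `|h|`. -/
def IndexedDomains.PolyTime (D : IndexedDomains) : Prop :=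
  ∃ p : Polynomial ℕ, ComputableWithin D.code (fun n => List.replicate n true) D.size
    (fun h => p.eval (D.code h).length)

/-- A family `(S_h, F_h)` of set systems over given domains `S_h`. -/
abbrev SetSystemFamily (D : IndexedDomains) : Type :=
  ∀ h : D.H, Set (Finset (Fin (D.size h)))

/-- The string given to an oracle on the query `(h, X)`, `X ⊆ S_h`: the code of `h`, followed, in a
second copy of the binary alphabet, by the characteristic vector of `X`. -/
def IndexedDomains.queryCode (D : IndexedDomains) (q : Σ h : D.H, Finset (Fin (D.size h))) :
    List (Bool ⊕ Bool) :=
  (D.code q.1).map Sum.inl ++ (List.ofFn (fun i => decide (i ∈ q.2))).map Sum.inr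

open Classical in
/-- The family is given by a uniform polynomial-time oracle: a single algorithm decides, given `h`
and `X ⊆ S_h`, whether `X ∈ F_h`, in time polynomial in `|S_h|`. -/
def UniformPolyTimeOracle {D : IndexedDomains} (F : SetSystemFamily D) : Prop :=
  ∃ p : Polynomial ℕ, ComputableWithin D.queryCode (fun b : Bool => [b])
    (fun q => decide (q.2 ∈ F q.1)) (fun q => p.eval (D.size q.1))

/-- The dual parameterized intersection problem: given `h` and `k`, is there `X ∈ F_h ∩ G_h` with
`|X| = |S_h| - k`? (Written additively: for `k > |S_h|` there is none.) -/
def dualIntersectionProblem {D : IndexedDomains} (F G : SetSystemFamily D) : ParamProblem where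
  Inst := D.H
  code := D.code
  code_injective := D.code_injective
  yes := {p | ∃ X ∈ F p.1 ∩ G p.1, X.card + p.2 = D.size p.1}

/-!
Fix a circuit `C` with `n` variables and a weight `k`. Consider a ground set that consists of the
variables and of at least one further element, and describe a set `X` by the variables that are
*absent* from it.

* The matroid (`missingFamily`) consists of the sets from which at least `k` variables are absent,
  and of the empty set. For `k ≤ n` this is a uniform matroid with the further elements as coloops.
* The greedoid (`lockedFamily`) lets a set contain further elements only if fewer than `k` variables
  are absent, or if exactly `k` are absent and setting these to true satisfies `C`. This condition
  is monotone in `X` for a trivial reason: once one of exactly `k` absent variables is added, fewer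
  than `k` are absent. A set system that locks elements by a monotone condition is a greedoid
  (`isGreedoid_locked`).

A common set that misses exactly `k` elements of the ground set has to contain a further element and
has to miss exactly `k` variables, which then satisfy `C`; this is `mem_weightedCircuitSat_iff`. So
`(C, k)` is a yes-instance of weighted circuit satisfiability if and only if the systems with index
`(C, k)` have a solution for the parameter `k`. The condition on `X` has to know `k`, because the
dual intersection problem is monotone in its parameter, so `k` becomes a part of the index.

The ground set is given as many elements as the code of `(C, k)` has bits. It is then larger than
`n + k`, it is trivial to compute, and polynomial time in its size is polynomial time in the length
of the code.

The rest is about machines. To exhibit them, structured commands over stacks (`Cmd`) get a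
big-step semantics with a time bound (`Cmd.Exec`) and a compilation to `TM2` statements that is
sound (`Cmd.Exec.stepsTo`). One command reads an index and a characteristic vector, evaluates the
circuit at the absent variables and compares their number with `k` (`Oracle.exec_oracle`); both
oracles are this command with different final tables. For hardness, a machine that reduces a
language to weighted circuit satisfiability is followed by a command that copies the parameter,
which the machine leaves as a row of markers, into the code of the index
(`ParamProblem.ReducesTo.trans_appendParam`). That command runs in linear time in the output of the
machine, which is linear in its running time (`Turing.FinTM2.exists_output_length_le`).
-/

open Turing

/-! ### Bounded runs of a transition system -/

/-- `StepsTo f n a b`: iterating the partial step function `f` leads from `a` to `b` in at most `n`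
steps. -/
inductive StepsTo {α : Type} (f : α → Option α) : ℕ → α → α → Prop
  | refl (n : ℕ) (a : α) : StepsTo f n a a
  | step {n : ℕ} {a b c : α} : f a = some b → StepsTo f n b c → StepsTo f (n + 1) a c

namespace StepsTo

variable {α : Type} {f : α → Option α}

theorem mono {n m : ℕ} {a b : α} (h : StepsTo f n a b) (hnm : n ≤ m) : StepsTo f m a b := by
  induction h generalizing m with
  | refl n a => exact refl m a
  | step hab _ ih =>
    obtain ⟨m, rfl⟩ : ∃ m', m = m' + 1 := ⟨m - 1, by omega⟩
    exact step hab (ih (by omega))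

theorem trans {n m : ℕ} {a b c : α} (h : StepsTo f n a b) (h' : StepsTo f m b c) :
    StepsTo f (n + m) a c := by
  induction h with
  | refl n a => exact h'.mono (by omega)
  | step hab _ ih => exact (step hab (ih h')).mono (by omega)

theorem single {a b : α} (h : f a = some b) : StepsTo f 1 a b := step h (refl 0 b)

theorem iterate_none (n : ℕ) : (flip bind f)^[n] none = none := by
  induction n with
  | zero => rfl
  | succ n ih => rw [Function.iterate_succ_apply]; exact ih

theorem iff_evalsToInTime {n : ℕ} {a b : α} :
    StepsTo f n a b ↔ Nonempty (StateTransition.EvalsToInTime f a (some b) n) := by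
  constructor
  · intro h
    induction h with
    | refl n a => exact ⟨⟨⟨0, rfl⟩, Nat.zero_le n⟩⟩
    | step hab _ ih =>
      obtain ⟨⟨j, hj⟩, hjn⟩ := ih
      refine ⟨⟨⟨j + 1, ?_⟩, Nat.succ_le_succ hjn⟩⟩
      rw [Function.iterate_succ_apply]
      change (flip bind f)^[j] (f _) = _
      rw [hab]
      exact hj
  · rintro ⟨⟨⟨j, hj⟩, hjn⟩⟩
    refine StepsTo.mono (n := j) ?_ hjn
    clear hjn
    induction j generalizing a with
    | zero =>
      obtain rfl : a = b := Option.some.inj hj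
      exact refl 0 a
    | succ j ih =>
      rw [Function.iterate_succ_apply] at hj
      change (flip bind f)^[j] (f a) = _ at hj
      cases hfa : f a with
      | none => rw [hfa, iterate_none] at hj; cases hj
      | some c => rw [hfa] at hj; exact step hfa (ih hj)

end StepsTo

/-! ### Structured commands over stacks -/

/-- A block (a `TM2` statement without jumps, ending in `halt`) is turned into a statement that
continues at the label `next`. -/
def blockStmt {K : Type} {Γ : K → Type} {σ Λ : Type} (next : Λ) :
    TM2.Stmt Γ Unit σ → TM2.Stmt Γ Λ σ
  | .push k f q => .push k f (blockStmt next q)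
  | .peek k f q => .peek k f (blockStmt next q)
  | .pop k f q => .pop k f (blockStmt next q)
  | .load f q => .load f (blockStmt next q)
  | .branch f q r => .branch f (blockStmt next q) (blockStmt next r)
  | .goto _ => .goto fun _ => next
  | .halt => .goto fun _ => next

theorem stepAux_blockStmt {K : Type} [DecidableEq K] {Γ : K → Type} {σ Λ : Type} (next : Λ)
    (q : TM2.Stmt Γ Unit σ) (v : σ) (S : ∀ k, List (Γ k)) :
    TM2.stepAux (blockStmt next q) v S =
      ⟨some next, (TM2.stepAux q v S).var, (TM2.stepAux q v S).stk⟩ := by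
  induction q generalizing v S with
  | branch f q r ihq ihr => cases h : f v <;> simp [blockStmt, ihq, ihr, h]
  | _ => simp_all [blockStmt]

/-- Structured commands for a machine with stacks `Γ` and a finite register `σ`: blocks that take a
single step, sequencing, conditionals, and loops that test the register after each run of the
body. -/
inductive Cmd {K : Type} (Γ : K → Type) (σ : Type)
  | block (q : TM2.Stmt Γ Unit σ)
  | seq (c d : Cmd Γ σ)
  | ite (b : σ → Bool) (c d : Cmd Γ σ)
  | doWhile (c : Cmd Γ σ) (b : σ → Bool)

namespace Cmd

variable {K : Type} {Γ : K → Type} {σ : Type}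

/-- The program points of a command. -/
def Lab : Cmd Γ σ → Type
  | block _ => Unit
  | seq c d => c.Lab ⊕ d.Lab
  | ite _ c d => Option (c.Lab ⊕ d.Lab)
  | doWhile c _ => Option c.Lab

/-- The program point at which a command starts. -/
def entry : (c : Cmd Γ σ) → c.Lab
  | block _ => ()
  | seq c _ => Sum.inl c.entry
  | ite _ _ _ => none
  | doWhile c _ => some c.entry

instance instFiniteLab : (c : Cmd Γ σ) → Finite c.Lab
  | block _ => inferInstanceAs (Finite Unit)
  | seq c d =>
    have := instFiniteLab c
    have := instFiniteLab d
    inferInstanceAs (Finite (c.Lab ⊕ d.Lab))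
  | ite _ c d =>
    have := instFiniteLab c
    have := instFiniteLab d
    inferInstanceAs (Finite (Option (c.Lab ⊕ d.Lab)))
  | doWhile c _ =>
    have := instFiniteLab c
    inferInstanceAs (Finite (Option c.Lab))

/-- The `TM2` statement at each program point of a command, when its program points are embedded by
`emb` into the labels of a larger machine that is to continue at the label `next`. -/
def stmt {Λ : Type} : (c : Cmd Γ σ) → (c.Lab → Λ) → Λ → c.Lab → TM2.Stmt Γ Λ σ
  | block q, _, next, _ => blockStmt next q
  | seq c d, emb, _, Sum.inl l => c.stmt (fun l => emb (Sum.inl l)) (emb (Sum.inr d.entry)) l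
  | seq _ d, emb, next, Sum.inr l => d.stmt (fun l => emb (Sum.inr l)) next l
  | ite b c d, emb, _, none =>
    .branch b (.goto fun _ => emb (some (Sum.inl c.entry)))
      (.goto fun _ => emb (some (Sum.inr d.entry)))
  | ite _ c _, emb, next, some (Sum.inl l) => c.stmt (fun l => emb (some (Sum.inl l))) next l
  | ite _ _ d, emb, next, some (Sum.inr l) => d.stmt (fun l => emb (some (Sum.inr l))) next l
  | doWhile c b, emb, next, none =>
    .branch b (.goto fun _ => emb (some c.entry)) (.goto fun _ => next)
  | doWhile c _, emb, _, some l => c.stmt (fun l => emb (some l)) (emb none) l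

variable [DecidableEq K]

/-- `Exec c v S v' S' n`: started with the register `v` and the stacks `S`, the command `c` ends
with the register `v'` and the stacks `S'`, after at most `n` steps. -/
inductive Exec : Cmd Γ σ → σ → (∀ k, List (Γ k)) → σ → (∀ k, List (Γ k)) → ℕ → Prop
  | block {q v S v' S'} : TM2.stepAux q v S = ⟨none, v', S'⟩ → Exec (block q) v S v' S' 1
  | seq {c d v S v' S' v'' S'' n m} :
    Exec c v S v' S' n → Exec d v' S' v'' S'' m → Exec (seq c d) v S v'' S'' (n + m)
  | ite_true {b c d v S v' S' n} :
    b v = true → Exec c v S v' S' n → Exec (ite b c d) v S v' S' (n + 1)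
  | ite_false {b c d v S v' S' n} :
    b v = false → Exec d v S v' S' n → Exec (ite b c d) v S v' S' (n + 1)
  | done {b c v S v' S' n} :
    Exec c v S v' S' n → b v' = false → Exec (doWhile c b) v S v' S' (n + 1)
  | next {b c v S v' S' v'' S'' n m} :
    Exec c v S v' S' n → b v' = true → Exec (doWhile c b) v' S' v'' S'' m →
      Exec (doWhile c b) v S v'' S'' (m + n + 1)
  | mono {c v S v' S' n m} : Exec c v S v' S' n → n ≤ m → Exec c v S v' S' m

theorem Exec.block_done {e : Cmd Γ σ} {q b v S v' S' n} (he : e = doWhile (.block q) b)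
    (hq : TM2.stepAux q v S = ⟨none, v', S'⟩) (hb : b v' = false) (hn : 2 ≤ n) :
    Exec e v S v' S' n := by
  subst he
  exact .mono (.done (.block hq) hb) hn

theorem Exec.block_next {e : Cmd Γ σ} {q b v S v' S' v'' S'' n m} (he : e = doWhile (.block q) b)
    (hq : TM2.stepAux q v S = ⟨none, v', S'⟩) (hb : b v' = true) (h : Exec e v' S' v'' S'' n)
    (hn : n + 2 ≤ m) : Exec e v S v'' S'' m := by
  subst he
  exact .mono (.next (.block hq) hb h) hn

/-- Soundness of the compilation of commands to `TM2` statements. -/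
theorem Exec.stepsTo {Λ : Type} {m : Λ → TM2.Stmt Γ Λ σ} {c : Cmd Γ σ} {v v' : σ}
    {S S' : ∀ k, List (Γ k)} {n : ℕ} (h : Exec c v S v' S' n) :
    ∀ (emb : c.Lab → Λ) (next : Λ), (∀ l, m (emb l) = c.stmt emb next l) →
      StepsTo (TM2.step m) n ⟨some (emb c.entry), v, S⟩ ⟨some next, v', S'⟩ := by
  induction h with
  | block hq =>
    intro emb next hm
    refine StepsTo.single ?_
    rw [TM2.step, hm, stmt, stepAux_blockStmt, hq]
  | seq _ _ ihc ihd =>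
    intro emb next hm
    exact (ihc _ _ fun l => hm (Sum.inl l)).trans (ihd _ next fun l => hm (Sum.inr l))
  | ite_true hb _ ih =>
    intro emb next hm
    refine StepsTo.step ?_ (ih _ next fun l => hm (some (Sum.inl l)))
    rw [TM2.step, hm, entry, stmt]
    simp [hb]
  | ite_false hb _ ih =>
    intro emb next hm
    refine StepsTo.step ?_ (ih _ next fun l => hm (some (Sum.inr l)))
    rw [TM2.step, hm, entry, stmt]
    simp [hb]
  | done _ hb ih =>
    intro emb next hm
    refine (ih _ _ fun l => hm (some l)).trans (StepsTo.single ?_)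
    refine (congrArg (fun q => some (TM2.stepAux q _ _)) (hm none)).trans ?_
    simp [stmt, hb]
  | next _ hb _ ihc ih =>
    intro emb next hm
    refine ((ihc _ _ fun l => hm (some l)).trans (StepsTo.step ?_ (ih emb next hm))).mono
      (by omega)
    refine (congrArg (fun q => some (TM2.stepAux q _ _)) (hm none)).trans ?_
    simp [stmt, hb, entry]
  | mono _ hnm ih =>
    intro emb next hm
    exact (ih emb next hm).mono hnm

/-! ### Machines given by commands -/

/-- All stacks are empty except for `k`, which holds `s`. -/
def single (k : K) (s : List (Γ k)) : ∀ j, List (Γ j) := Function.update (fun _ => []) k s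

end Cmd

theorem Turing.initList_eq (tm : FinTM2) (s : List (tm.Γ tm.k₀)) :
    initList tm s = ⟨some tm.main, tm.initialState, Cmd.single tm.k₀ s⟩ := by
  unfold initList Cmd.single
  congr 1
  funext k
  by_cases h : k = tm.k₀
  · subst h; simp
  · simp [h]

theorem Turing.haltList_eq (tm : FinTM2) (s : List (tm.Γ tm.k₁)) :
    haltList tm s = ⟨none, tm.initialState, Cmd.single tm.k₁ s⟩ := by
  unfold haltList Cmd.single
  congr 1
  funext k
  by_cases h : k = tm.k₁
  · subst h; simp
  · simp [h]

/-- `TM2OutputsInTime` in terms of `StepsTo`. -/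
theorem Turing.outputsInTime_iff (tm : FinTM2) (s : List (tm.Γ tm.k₀)) (t : List (tm.Γ tm.k₁))
    (n : ℕ) : Nonempty (TM2OutputsInTime tm s (some t) n) ↔
      StepsTo (TM2.step tm.m) n ⟨some tm.main, tm.initialState, Cmd.single tm.k₀ s⟩
        ⟨none, tm.initialState, Cmd.single tm.k₁ t⟩ := by
  rw [← initList_eq, ← haltList_eq]
  exact StepsTo.iff_evalsToInTime.symm

namespace Cmd

section Machine

variable {K : Type} [DecidableEq K] [Fintype K] {Γ : K → Type} {σ : Type} [Fintype σ]

/-- The machine that runs a command and then halts. -/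
noncomputable def toFinTM2 (c : Cmd Γ σ) (k₀ k₁ : K) [Fintype (Γ k₀)] (init : σ) : FinTM2 where
  k₀ := k₀
  k₁ := k₁
  Γ := Γ
  Λ := Option c.Lab
  main := some c.entry
  ΛFin := Fintype.ofFinite _
  σ := σ
  initialState := init
  m
    | none => .halt
    | some l => c.stmt some none l

theorem Exec.outputsInTime {c : Cmd Γ σ} {k₀ k₁ : K} [Fintype (Γ k₀)] {init : σ}
    {s : List (Γ k₀)} {t : List (Γ k₁)} {n : ℕ}
    (h : Exec c init (single k₀ s) init (single k₁ t) n) :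
    Nonempty (TM2OutputsInTime (c.toFinTM2 k₀ k₁ init) s (some t) (n + 1)) := by
  refine (outputsInTime_iff (c.toFinTM2 k₀ k₁ init) s t (n + 1)).2 ?_
  exact (h.stepsTo (m := (c.toFinTM2 k₀ k₁ init).m) some none fun _ => rfl).trans
    (StepsTo.single rfl)

/-- The function computed by a command that restores its register and empties all stacks but the
output stack. -/
theorem computableWithin (c : Cmd Γ σ) (k₀ k₁ : K) [Fintype (Γ k₀)] (init : σ) {α β : Type}
    {ea : α → List (Γ k₀)} {eb : β → List (Γ k₁)} {f : α → β} {T : α → ℕ}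
    (h : ∀ a, ∃ n, Exec c init (single k₀ (ea a)) init (single k₁ (eb (f a))) n ∧ n + 1 ≤ T a) :
    ComputableWithin ea eb f T := by
  refine ⟨⟨c.toFinTM2 k₀ k₁ init, Equiv.refl _, Equiv.refl _⟩, fun a => ?_⟩
  obtain ⟨n, hn, hT⟩ := h a
  rw [← List.map_id (ea a), ← List.map_id (eb (f a))] at hn
  obtain ⟨ha⟩ := hn.outputsInTime
  exact ⟨⟨ha.1, ha.2.trans hT⟩⟩

end Machine

end Cmd

/-! ### Running a command after a machine -/

namespace Turing

variable {K K' : Type} {Γ : K → Type} {Γ' : K' → Type} {Λ Λ' σ σ' : Type}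

/-- The alphabets of two families of stacks side by side. -/
abbrev joinAlph (Γ : K → Type) (Γ' : K' → Type) : K ⊕ K' → Type
  | Sum.inl k => Γ k
  | Sum.inr k => Γ' k

/-- A statement of a machine, as a statement of a machine with more stacks, more labels and a larger
register; instead of halting it jumps to the label `next`. -/
def liftStmt (next : Λ') : TM2.Stmt Γ Λ σ → TM2.Stmt (joinAlph Γ Γ') (Λ ⊕ Λ') (σ × σ')
  | .push k f q => .push (Sum.inl k) (fun v => f v.1) (liftStmt next q)
  | .peek k f q => .peek (Sum.inl k) (fun v s => (f v.1 s, v.2)) (liftStmt next q)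
  | .pop k f q => .pop (Sum.inl k) (fun v s => (f v.1 s, v.2)) (liftStmt next q)
  | .load f q => .load (fun v => (f v.1, v.2)) (liftStmt next q)
  | .branch f q r => .branch (fun v => f v.1) (liftStmt next q) (liftStmt next r)
  | .goto f => .goto fun v => Sum.inl (f v.1)
  | .halt => .goto fun _ => Sum.inr next

/-- Two families of stacks side by side. -/
def joinStk (S : ∀ k, List (Γ k)) (T : ∀ k, List (Γ' k)) : ∀ k, List (joinAlph Γ Γ' k)
  | Sum.inl k => S k
  | Sum.inr k => T k

section

variable [DecidableEq K] [DecidableEq K']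

theorem update_joinStk_inl (S : ∀ k, List (Γ k)) (T : ∀ k, List (Γ' k)) (k : K)
    (s : List (Γ k)) :
    Function.update (joinStk S T) (Sum.inl k) s = joinStk (Function.update S k s) T := by
  funext j
  rcases j with j | j
  · by_cases h : j = k
    · subst h; simp [joinStk]
    · have h' : (Sum.inl j : K ⊕ K') ≠ Sum.inl k := by simpa using h
      simp [joinStk, h]
  · simp [joinStk]

theorem update_joinStk_inr (S : ∀ k, List (Γ k)) (T : ∀ k, List (Γ' k)) (k : K')
    (s : List (Γ' k)) :
    Function.update (joinStk S T) (Sum.inr k) s = joinStk S (Function.update T k s) := by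
  funext j
  rcases j with j | j
  · simp [joinStk]
  · by_cases h : j = k
    · subst h; simp [joinStk]
    · have h' : (Sum.inr j : K ⊕ K') ≠ Sum.inr k := by simpa using h
      simp [joinStk, h]

/-- The label of the larger machine that corresponds to a (possibly halted) label of the smaller
one. -/
def liftLabel (next : Λ') : Option Λ → Λ ⊕ Λ'
  | some l => Sum.inl l
  | none => Sum.inr next

theorem stepAux_liftStmt (next : Λ') (q : TM2.Stmt Γ Λ σ) (v : σ) (v' : σ')
    (S : ∀ k, List (Γ k)) (T : ∀ k, List (Γ' k)) :
    TM2.stepAux (liftStmt next q) (v, v') (joinStk S T) =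
      ⟨some (liftLabel next (TM2.stepAux q v S).l), ((TM2.stepAux q v S).var, v'),
        joinStk (TM2.stepAux q v S).stk T⟩ := by
  induction q generalizing v S with
  | push k f q ih =>
    rw [liftStmt, TM2.stepAux, TM2.stepAux, update_joinStk_inl]; exact ih _ _
  | peek k f q ih => exact ih _ _
  | pop k f q ih =>
    rw [liftStmt, TM2.stepAux, TM2.stepAux, update_joinStk_inl]; exact ih _ _
  | load f q ih => exact ih _ _
  | branch f q r ihq ihr => cases h : f v <;> simp [liftStmt, ihq, ihr, h]
  | goto f => rfl
  | halt => rfl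

/-- The larger machine simulates the smaller one step by step; where the smaller one has halted, the
larger one is at the label `next`. -/
theorem stepsTo_lift {m : Λ → TM2.Stmt Γ Λ σ}
    {m' : Λ ⊕ Λ' → TM2.Stmt (joinAlph Γ Γ') (Λ ⊕ Λ') (σ × σ')} {next : Λ'}
    (hm : ∀ l, m' (Sum.inl l) = liftStmt next (m l)) (v' : σ') (T : ∀ k, List (Γ' k)) {n : ℕ}
    {a b : TM2.Cfg Γ Λ σ} (h : StepsTo (TM2.step m) n a b) :
    StepsTo (TM2.step m') n ⟨some (liftLabel next a.l), (a.var, v'), joinStk a.stk T⟩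
      ⟨some (liftLabel next b.l), (b.var, v'), joinStk b.stk T⟩ := by
  induction h with
  | refl n a => exact StepsTo.refl _ _
  | @step n a b c hab _ ih =>
    refine StepsTo.step ?_ ih
    obtain ⟨_ | l, v, S⟩ := a
    · cases hab
    · obtain rfl := Option.some.inj hab
      rw [liftLabel, TM2.step, hm, stepAux_liftStmt]

end

/-- The machine that runs `M` and then the command `c`, which has additional stacks and an
additional register. The output is expected on the output stack of `M`. -/
noncomputable def FinTM2.andThen (M : FinTM2) [DecidableEq K'] [Fintype K'] [Fintype σ']
    (init : σ') (c : Cmd (joinAlph M.Γ Γ') (M.σ × σ')) : FinTM2 where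
  K := M.K ⊕ K'
  kDecidableEq := inferInstance
  kFin := have := M.kFin; inferInstance
  k₀ := Sum.inl M.k₀
  k₁ := Sum.inl M.k₁
  Γ := joinAlph M.Γ Γ'
  Γk₀Fin := M.Γk₀Fin
  Λ := M.Λ ⊕ Option c.Lab
  main := Sum.inl M.main
  ΛFin := have := M.ΛFin; Fintype.ofFinite _
  σ := M.σ × σ'
  initialState := (M.initialState, init)
  σFin := have := M.σFin; inferInstance
  m
    | Sum.inl l => liftStmt (some c.entry) (M.m l)
    | Sum.inr none => .halt
    | Sum.inr (some l) => c.stmt (fun l => Sum.inr (some l)) (Sum.inr none) l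

theorem joinStk_single [DecidableEq K] [DecidableEq K'] (k : K) (s : List (Γ k)) :
    joinStk (Cmd.single k s) (fun k' : K' => ([] : List (Γ' k'))) =
      Cmd.single (Sum.inl k : K ⊕ K') s := by
  rw [Cmd.single, ← update_joinStk_inl, Cmd.single]
  congr 1
  funext j
  cases j <;> rfl

theorem FinTM2.andThen_outputsInTime (M : FinTM2) [DecidableEq K'] [Fintype K'] [Fintype σ']
    {init : σ'} {c : Cmd (joinAlph M.Γ Γ') (M.σ × σ')} {s : List (M.Γ M.k₀)}
    {t t' : List (M.Γ M.k₁)} {n n' : ℕ} (h : Nonempty (TM2OutputsInTime M s (some t) n))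
    (hc : Cmd.Exec c (M.initialState, init)
      (joinStk (Cmd.single M.k₁ t) fun _ => []) (M.initialState, init)
      (joinStk (Cmd.single M.k₁ t') fun _ => []) n') :
    Nonempty (TM2OutputsInTime (M.andThen init c) s (some t') (n + n' + 1)) := by
  rw [outputsInTime_iff] at h
  refine (outputsInTime_iff (M.andThen init c) s t' _).2 ?_
  have h1 := stepsTo_lift (m' := (M.andThen init c).m) (next := some c.entry) (fun _ => rfl) init
    (fun _ => []) h
  have h2 := hc.stepsTo (m := (M.andThen init c).m) (fun l => Sum.inr (some l)) (Sum.inr none)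
    fun _ => rfl
  have h3 := (h1.trans h2).trans (StepsTo.single (b := ⟨none, _, _⟩) rfl)
  rw [joinStk_single, joinStk_single] at h3
  exact h3

/-! ### The length of the output of a machine -/

/-- An upper bound for the number of symbols that a statement pushes in one step. -/
def pushCount : TM2.Stmt Γ Λ σ → ℕ
  | .push _ _ q => pushCount q + 1
  | .peek _ _ q => pushCount q
  | .pop _ _ q => pushCount q
  | .load _ q => pushCount q
  | .branch _ q r => pushCount q + pushCount r
  | .goto _ => 0
  | .halt => 0

theorem length_stepAux_le [DecidableEq K] (q : TM2.Stmt Γ Λ σ) (v : σ) (S : ∀ k, List (Γ k))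
    (k : K) : ((TM2.stepAux q v S).stk k).length ≤ (S k).length + pushCount q := by
  induction q generalizing v S with
  | push k' f q ih =>
    refine (ih v _).trans ?_
    by_cases h : k = k'
    · subst h; simp [pushCount]; omega
    · simp [pushCount, h]
  | peek k' f q ih => exact ih _ _
  | pop k' f q ih =>
    refine (ih _ _).trans ?_
    by_cases h : k = k'
    · subst h; simp [pushCount]
    · simp [pushCount, h]
  | load f q ih => exact ih _ _
  | branch f q r ihq ihr =>
    have h1 := ihq v S
    have h2 := ihr v S
    cases h : f v <;> simp only [TM2.stepAux, h, cond_true, cond_false, pushCount] <;> omega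
  | goto f => simp [pushCount]
  | halt => simp [pushCount]

theorem length_stk_le [DecidableEq K] {m : Λ → TM2.Stmt Γ Λ σ} {B : ℕ}
    (hB : ∀ l, pushCount (m l) ≤ B) (k : K) {n : ℕ} {a b : TM2.Cfg Γ Λ σ}
    (h : StepsTo (TM2.step m) n a b) : (b.stk k).length ≤ (a.stk k).length + B * n := by
  induction h with
  | refl n a => omega
  | @step n a b c hab _ ih =>
    obtain ⟨_ | l, v, S⟩ := a
    · cases hab
    · obtain rfl := Option.some.inj hab
      have h1 := length_stepAux_le (m l) v S k
      have h2 := hB l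
      rw [Nat.mul_succ]
      simp only at ih ⊢
      omega

/-- In each step a machine pushes a bounded number of symbols, so its output is linearly bounded in
the length of the input and the running time. -/
theorem FinTM2.exists_output_length_le (M : FinTM2) : ∃ B : ℕ, ∀ (s : List (M.Γ M.k₀))
    (t : List (M.Γ M.k₁)) (n : ℕ), Nonempty (TM2OutputsInTime M s (some t) n) →
      t.length ≤ s.length + B * n := by
  have := M.ΛFin
  refine ⟨∑ l, pushCount (M.m l), fun s t n h => ?_⟩
  rw [outputsInTime_iff] at h
  have h1 := length_stk_le (B := ∑ l, pushCount (M.m l))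
    (fun l => Finset.single_le_sum (f := fun l => pushCount (M.m l)) (fun _ _ => Nat.zero_le _)
      (Finset.mem_univ l)) M.k₁ h
  have h2 : ((Cmd.single M.k₀ s : ∀ k, List (M.Γ k)) M.k₁).length ≤ s.length := by
    by_cases h : M.k₁ = M.k₀
    · have h3 : ∀ j, j = M.k₀ →
          ((Cmd.single M.k₀ s : ∀ k, List (M.Γ k)) j).length ≤ s.length := by
        rintro j rfl
        simp [Cmd.single]
      exact h3 _ h
    · simp [Cmd.single, h]
  simp only [Cmd.single, Function.update_self] at h1 h2
  omega

end Turing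

/-! ### Copying the parameter into the instance -/

namespace Turing.FinTM2

variable (M : FinTM2) (e : M.Γ M.k₁ ≃ Option Bool)

/-- The alphabets of the stacks of `M` and of two additional stacks. -/
abbrev markAlph : M.K ⊕ Bool → Type := joinAlph M.Γ fun _ : Bool => Option Bool

/-- The register of `M`, and a register for a symbol popped from one of the other stacks. -/
abbrev MarkReg : Type := M.σ × Option (Option Bool)

/-- The output stack of `M` holds `x`, the two additional stacks hold `a` and `b`, and all other
stacks are empty. -/
def markStk (x : List (M.Γ M.k₁)) (a b : List (Option Bool)) : ∀ k, List (M.markAlph k) :=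
  joinStk (Cmd.single M.k₁ x) fun i => bif i then b else a

variable (x y : List (M.Γ M.k₁)) (a b c : List (Option Bool))

@[simp] theorem markStk_out : M.markStk x a b (Sum.inl M.k₁) = x := by
  simp [markStk, joinStk, Cmd.single]

@[simp] theorem markStk_false : M.markStk x a b (Sum.inr false) = a := rfl

@[simp] theorem markStk_true : M.markStk x a b (Sum.inr true) = b := rfl

@[simp] theorem update_markStk_out :
    Function.update (M.markStk x a b) (Sum.inl M.k₁) y = M.markStk y a b := by
  rw [markStk, update_joinStk_inl, Cmd.single, Function.update_idem]
  rfl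

@[simp] theorem update_markStk_false :
    Function.update (M.markStk x a b) (Sum.inr false) c = M.markStk x c b := by
  rw [markStk, update_joinStk_inr, markStk]
  congr 1
  funext i
  cases i <;> rfl

@[simp] theorem update_markStk_true :
    Function.update (M.markStk x a b) (Sum.inr true) c = M.markStk x a c := by
  rw [markStk, update_joinStk_inr, markStk]
  congr 1
  funext i
  cases i <;> rfl

/-- Move the output onto the first additional stack, which reverses it and so brings the markers to
the top. -/
def unloadOutput : Cmd M.markAlph M.MarkReg :=
  .doWhile
    (.block
      (.pop (Sum.inl M.k₁) (fun v s => (v.1, s.map e))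
        (.branch (fun v => v.2.isSome)
          (.push (Sum.inr false) (fun v => v.2.getD none) .halt) .halt)))
    fun v => v.2.isSome

/-- Move the markers back to the output stack, and push a symbol `true` onto the second additional
stack for each of them. The first symbol that is not a marker is returned to its stack. -/
def splitMarkers : Cmd M.markAlph M.MarkReg :=
  .doWhile
    (.block
      (.pop (Sum.inr false) (fun v s => (v.1, s))
        (.branch (fun v => v.2 == some none)
          (.push (Sum.inl M.k₁) (fun _ => e.symm none)
            (.push (Sum.inr true) (fun _ => some true) .halt))
          (.branch (fun v => v.2.isSome)
            (.push (Sum.inr false) (fun v => v.2.getD none) .halt) .halt))))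
    fun v => v.2 == some none

/-- Move one of the additional stacks onto the output stack. -/
def loadOutput (i : Bool) : Cmd M.markAlph M.MarkReg :=
  .doWhile
    (.block
      (.pop (Sum.inr i) (fun v s => (v.1, s))
        (.branch (fun v => v.2.isSome)
          (.push (Sum.inl M.k₁) (fun v => e.symm (v.2.getD none)) .halt) .halt)))
    fun v => v.2.isSome

/-- Insert into the output, a word over `Bool` followed by markers, one symbol `true` for each
marker, between the word and the markers. -/
def duplicateMarkers : Cmd M.markAlph M.MarkReg :=
  .seq (M.unloadOutput e) <| .seq (M.splitMarkers e) <|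
    .seq (M.loadOutput e true) (M.loadOutput e false)

theorem exec_unloadOutput (v : M.MarkReg) (x : List (Option Bool)) (a b : List (Option Bool)) :
    Cmd.Exec (M.unloadOutput e) v (M.markStk (x.map e.symm) a b) (v.1, none)
      (M.markStk [] (x.reverse ++ a) b) (2 * x.length + 2) := by
  induction x generalizing v a with
  | nil =>
    refine .mono (.done (.block (v' := (v.1, none)) (S' := M.markStk [] a b) ?_) rfl) (by simp)
    simp
  | cons s x ih =>
    rw [List.reverse_cons, List.append_assoc]
    refine .mono (.next (.block (v' := (v.1, some s))
      (S' := M.markStk (x.map e.symm) (s :: a) b) ?_) rfl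
      (ih (v.1, some s) (s :: a))) (by simp; omega)
    simp

theorem exec_splitMarkers (v : M.MarkReg) (n : ℕ) (x : List (M.Γ M.k₁)) (w : List Bool)
    (b : List (Option Bool)) :
    ∃ u, Cmd.Exec (M.splitMarkers e) v (M.markStk x (List.replicate n none ++ w.map some) b)
      (v.1, u) (M.markStk (List.replicate n (e.symm none) ++ x) (w.map some)
        (List.replicate n (some true) ++ b)) (2 * n + 2) := by
  induction n generalizing v x b with
  | zero =>
    cases w with
    | nil =>
      refine ⟨none, .mono (.done (.block (v' := (v.1, none)) ?_) rfl) (by simp)⟩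
      simp
    | cons s w =>
      refine ⟨some (some s), .mono (.done (.block (v' := (v.1, some (some s))) ?_) rfl) (by simp)⟩
      simp
  | succ n ih =>
    obtain ⟨u, hu⟩ := ih (v.1, some none) (e.symm none :: x) (some true :: b)
    have h1 : ∀ {α : Type} (s : α) l, List.replicate n s ++ s :: l =
        List.replicate (n + 1) s ++ l := by
      intro α s l
      rw [List.replicate_succ']
      simp
    rw [h1, h1] at hu
    refine ⟨u, .mono (.next (.block (v' := (v.1, some none)) ?_) rfl hu) (by omega)⟩
    simp [List.replicate_succ]

theorem exec_loadOutput_true (v : M.MarkReg) (x : List (M.Γ M.k₁)) (a b : List (Option Bool)) :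
    Cmd.Exec (M.loadOutput e true) v (M.markStk x a b) (v.1, none)
      (M.markStk (b.reverse.map e.symm ++ x) a []) (2 * b.length + 2) := by
  induction b generalizing v x with
  | nil =>
    refine .mono (.done (.block (v' := (v.1, none)) ?_) rfl) (by simp)
    simp
  | cons s b ih =>
    rw [List.reverse_cons, List.map_append, List.append_assoc]
    refine .mono (.next (.block (v' := (v.1, some s))
      (S' := M.markStk (e.symm s :: x) a b) ?_) rfl
      (ih (v.1, some s) (e.symm s :: x))) (by simp; omega)
    simp

theorem exec_loadOutput_false (v : M.MarkReg) (x : List (M.Γ M.k₁)) (a b : List (Option Bool)) :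
    Cmd.Exec (M.loadOutput e false) v (M.markStk x a b) (v.1, none)
      (M.markStk (a.reverse.map e.symm ++ x) [] b) (2 * a.length + 2) := by
  induction a generalizing v x with
  | nil =>
    refine .mono (.done (.block (v' := (v.1, none)) ?_) rfl) (by simp)
    simp
  | cons s a ih =>
    rw [List.reverse_cons, List.map_append, List.append_assoc]
    refine .mono (.next (.block (v' := (v.1, some s))
      (S' := M.markStk (e.symm s :: x) a b) ?_) rfl
      (ih (v.1, some s) (e.symm s :: x))) (by simp; omega)
    simp

theorem exec_duplicateMarkers (v : M.σ) (w : List Bool) (n : ℕ) :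
    Cmd.Exec (M.duplicateMarkers e) (v, none)
      (M.markStk ((w.map some ++ List.replicate n none).map e.symm) [] []) (v, none)
      (M.markStk (((w ++ List.replicate n true).map some ++ List.replicate n none).map e.symm) [] [])
      (6 * (w.length + n) + 8) := by
  have h1 := M.exec_unloadOutput e (v, none) (w.map some ++ List.replicate n none) [] []
  rw [List.append_nil, List.reverse_append, List.reverse_replicate, ← List.map_reverse] at h1
  obtain ⟨u, h2⟩ := M.exec_splitMarkers e (v, none) n [] w.reverse []
  rw [List.append_nil, List.append_nil] at h2
  have h3 := M.exec_loadOutput_true e (v, u) (List.replicate n (e.symm none))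
    (w.reverse.map some) (List.replicate n (some true))
  have h4 := M.exec_loadOutput_false e (v, none)
    (((List.replicate n (some true)).reverse.map e.symm) ++ List.replicate n (e.symm none))
    (w.reverse.map some) []
  have h5 := (h1.seq (h2.seq (h3.seq h4))).mono (m := 6 * (w.length + n) + 8) (by simp; omega)
  simpa [duplicateMarkers] using h5

theorem markStk_nil (x : List (M.Γ M.k₁)) :
    M.markStk x [] [] = joinStk (Cmd.single M.k₁ x) fun _ => [] := by
  rw [markStk]
  congr 1
  funext i
  cases i <;> rfl

end Turing.FinTM2

/-- A reduction to `P` becomes a reduction to any problem `Q` for which the instance `e` with the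
parameter `k` has a translation `t (e, k)` that is coded by the code of `e` followed by `k` in
unary. -/
theorem ParamProblem.ReducesTo.trans_appendParam {L P Q : ParamProblem} (h : L.ReducesTo P)
    (t : P.Inst × ℕ → Q.Inst)
    (hcode : ∀ p, Q.code (t p) = P.code p.1 ++ List.replicate p.2 true)
    (hyes : ∀ p : P.Inst × ℕ, p ∈ P.yes ↔ (t p, p.2) ∈ Q.yes) : L.ReducesTo Q := by
  obtain ⟨f, g, c, r, ⟨M, hM⟩, hr⟩ := h
  obtain ⟨B, hB⟩ := M.tm.exists_output_length_le
  -- The output of the given machine has length at most `|e| + k + B * T`, where `T` is its running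
  -- time, and the command that follows takes at most `6 * |output| + 8` steps.
  refine ⟨f, fun k => g k + 6 * (1 + k + B * g k) + 9, c + 1, fun p => t (r p, f p.2),
    ⟨⟨M.tm.andThen none (M.tm.duplicateMarkers M.outputAlphabet), M.inputAlphabet,
      M.outputAlphabet⟩, ?_⟩, fun e k => (hr e k).trans (hyes _)⟩
  intro p
  have h1 := hM p
  have h2 := hB _ _ _ h1
  have h3 : ParamProblem.pairCode Q (t (r p, f p.2), f p.2) =
      ((P.code (r p) ++ List.replicate (f p.2) true).map some ++
        List.replicate (f p.2) none) := by
    rw [ParamProblem.pairCode, hcode]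
  have h4 := M.tm.exec_duplicateMarkers M.outputAlphabet M.tm.initialState (P.code (r p)) (f p.2)
  rw [← h3, FinTM2.markStk_nil, FinTM2.markStk_nil] at h4
  obtain ⟨h5⟩ := FinTM2.andThen_outputsInTime M.tm h1 h4
  refine ⟨⟨h5.1, h5.2.trans ?_⟩⟩
  simp only [ParamProblem.pairCode, List.length_map, List.length_append, List.length_replicate]
    at h2
  set n := (L.code p.1).length
  set T := g p.2 * (n + 1) ^ c
  have hn : 1 ≤ (n + 1) ^ c := Nat.one_le_pow _ _ (Nat.succ_pos n)
  have hn' : n + 1 ≤ (n + 1) ^ (c + 1) := by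
    rw [pow_succ]; exact Nat.le_mul_of_pos_left _ hn
  have hT' : T ≤ g p.2 * (n + 1) ^ (c + 1) :=
    Nat.mul_le_mul_left _ (Nat.pow_le_pow_right (Nat.succ_pos n) (Nat.le_succ c))
  have hBT : B * T ≤ B * (g p.2 * (n + 1) ^ (c + 1)) := Nat.mul_le_mul_left _ hT'
  have hk : p.2 ≤ p.2 * (n + 1) ^ (c + 1) := Nat.le_mul_of_pos_right _ (by omega)
  have key : (g p.2 + 6 * (1 + p.2 + B * g p.2) + 9) * (n + 1) ^ (c + 1) =
      g p.2 * (n + 1) ^ (c + 1) + 15 * (n + 1) ^ (c + 1) + 6 * (p.2 * (n + 1) ^ (c + 1)) +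
        6 * (B * (g p.2 * (n + 1) ^ (c + 1))) := by ring
  change T + (6 * ((P.code (r p)).length + f p.2) + 8) + 1 ≤
    (g p.2 + 6 * (1 + p.2 + B * g p.2) + 9) * (n + 1) ^ (c + 1)
  rw [key]
  generalize g p.2 * (n + 1) ^ (c + 1) = GN at *
  generalize p.2 * (n + 1) ^ (c + 1) = kN at *
  generalize (n + 1) ^ (c + 1) = N at *
  generalize B * GN = BGN at *
  generalize B * T = BT at *
  clear key
  omega

/-! ### The oracle machine -/

namespace Oracle

/-- The work stacks of the oracle machine: the unread part of the code of the index, the unread part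
of the characteristic vector, the values of the wires (the last wire on top), a scratch stack,
a wire number in unary, and the number of absent variables in unary. -/
inductive Work
  | code | vec | wire | tmp | idx | cnt
  deriving DecidableEq

instance : Fintype Work := ⟨{.code, .vec, .wire, .tmp, .idx, .cnt}, by rintro ⟨⟩ <;> decide⟩

/-- The stacks of the oracle machine. -/
inductive Stack
  | inp | out | work (i : Work)
  deriving DecidableEq

instance : Fintype Stack :=
  ⟨insert .inp (insert .out (Finset.univ.image .work)), by rintro (_ | _ | i) <;> simp⟩

/-- The input stack carries the alphabet of oracle queries, all other stacks carry bits. -/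
abbrev Alph : Stack → Type
  | .inp => Bool ⊕ Bool
  | .out => Bool
  | .work _ => Bool

/-- The register of the oracle machine. -/
structure Reg where
  /-- the last symbol popped -/
  cur : Option Bool
  /-- a further popped symbol -/
  aux : Option Bool
  /-- the kind of a gate: `(false, false)` for `not`, `(false, true)` for `and`, and
  `(true, false)` for `or` -/
  bits : Bool × Bool
  /-- whether there is a further gate; while the input is split, whether the last symbol belongs
  to the code of the index -/
  more : Bool
  /-- the wire value read last -/
  a : Bool
  /-- the wire value read before that -/
  b : Bool
  /-- whether the set in the query is nonempty -/
  seen : Bool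
  /-- whether the set in the query contains an element that is not a variable -/
  pad : Bool
  /-- whether fewer variables than the parameter are absent from the set -/
  lt : Bool
  /-- whether more variables than the parameter are absent from the set -/
  gt : Bool

instance : Finite Reg :=
  Finite.of_injective
    (fun v : Reg => (v.cur, v.aux, v.bits, v.more, v.a, v.b, v.seen, v.pad, v.lt, v.gt)) (by
      rintro ⟨⟩ ⟨⟩ h
      simpa using h)

noncomputable instance : Fintype Reg := Fintype.ofFinite Reg

/-- The register at the start, which is restored before halting. -/
def Reg.init : Reg := ⟨none, none, (false, false), false, false, false, false, false, false, false⟩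

/-- The stacks with the given contents of the input, the output and the work stacks. -/
def stk (i : List (Bool ⊕ Bool)) (o : List Bool) (w : Work → List Bool) : ∀ k, List (Alph k)
  | .inp => i
  | .out => o
  | .work k => w k

/-- The given contents of the work stacks. -/
def work (code vec wire tmp idx cnt : List Bool) : Work → List Bool
  | .code => code
  | .vec => vec
  | .wire => wire
  | .tmp => tmp
  | .idx => idx
  | .cnt => cnt

section Stacks

variable (i i' : List (Bool ⊕ Bool)) (o o' : List Bool) (w : Work → List Bool)
  (c v u t d n x : List Bool)

@[simp] theorem stk_inp : stk i o w .inp = i := rfl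
@[simp] theorem stk_out : stk i o w .out = o := rfl
@[simp] theorem stk_work (k : Work) : stk i o w (.work k) = w k := rfl

@[simp] theorem update_stk_inp : Function.update (stk i o w) .inp i' = stk i' o w := by
  funext k; cases k <;> rfl

@[simp] theorem update_stk_out : Function.update (stk i o w) .out o' = stk i o' w := by
  funext k; cases k <;> rfl

@[simp] theorem update_stk_work (k : Work) :
    Function.update (stk i o w) (.work k) x = stk i o (Function.update w k x) := by
  funext j
  rcases j with _ | _ | j
  · rfl
  · rfl
  · by_cases h : j = k
    · subst h; simp
    · simp [h]

@[simp] theorem update_work_code :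
    Function.update (work c v u t d n) .code x = work x v u t d n := by
  funext k; cases k <;> rfl

@[simp] theorem update_work_vec :
    Function.update (work c v u t d n) .vec x = work c x u t d n := by
  funext k; cases k <;> rfl

@[simp] theorem update_work_wire :
    Function.update (work c v u t d n) .wire x = work c v x t d n := by
  funext k; cases k <;> rfl

@[simp] theorem update_work_tmp :
    Function.update (work c v u t d n) .tmp x = work c v u x d n := by
  funext k; cases k <;> rfl

@[simp] theorem update_work_idx :
    Function.update (work c v u t d n) .idx x = work c v u t x n := by
  funext k; cases k <;> rfl

@[simp] theorem update_work_cnt :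
    Function.update (work c v u t d n) .cnt x = work c v u t d x := by
  funext k; cases k <;> rfl

end Stacks

/-! ### The subprograms of the oracle machine -/

/-- Pop all symbols from the work stack `x`. -/
def clear (x : Work) : Cmd Alph Reg :=
  .doWhile (.block (.pop (.work x) (fun v s => { v with cur := s }) .halt)) fun v => v.cur.isSome

/-- Move the work stack `x` onto the work stack `y`, in reverse order. -/
def move (x y : Work) : Cmd Alph Reg :=
  .doWhile
    (.block
      (.pop (.work x) (fun v s => { v with cur := s })
        (.branch (fun v => v.cur.isSome) (.push (.work y) (fun v => v.cur.getD false) .halt)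
          .halt)))
    fun v => v.cur.isSome

/-- Separate the code of the index from the characteristic vector. -/
def split : Cmd Alph Reg :=
  .doWhile
    (.block
      (.pop .inp
        (fun v s => { v with cur := s.map (Sum.elim id id), more := (s.map Sum.isLeft).getD false })
        (.branch (fun v => v.cur.isSome)
          (.branch (fun v => v.more) (.push (.work .tmp) (fun v => v.cur.getD false) .halt)
            (.push (.work .idx) (fun v => v.cur.getD false) .halt))
          .halt)))
    fun v => v.cur.isSome

/-- Read the number of variables; the wire of a variable gets the value `true` when the variable is
absent from the set. -/
def readVars : Cmd Alph Reg :=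
  .doWhile
    (.block
      (.pop (.work .code) (fun v s => { v with cur := s })
        (.branch (fun v => v.cur == some true)
          (.pop (.work .vec) (fun v s => { v with aux := s, seen := v.seen || s == some true })
            (.push (.work .wire) (fun v => v.aux != some true)
              (.branch (fun v => v.aux != some true) (.push (.work .cnt) (fun _ => true) .halt)
                .halt)))
          .halt)))
    fun v => v.cur == some true

/-- Read the rest of the characteristic vector. -/
def readRest : Cmd Alph Reg :=
  .doWhile
    (.block
      (.pop (.work .vec)
        (fun v s => { v with
          cur := s, seen := v.seen || s == some true, pad := v.pad || s == some true })
        .halt))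
    fun v => v.cur.isSome

/-- Read the number of the output wire. -/
def readOut : Cmd Alph Reg :=
  .doWhile
    (.block
      (.pop (.work .code) (fun v s => { v with cur := s })
        (.branch (fun v => v.cur == some true) (.push (.work .idx) (fun _ => true) .halt) .halt)))
    fun v => v.cur == some true

/-- With the wires on the scratch stack, the first one on top, move as many of them back as the number
in unary on the work stack `x` says. -/
def skip (x : Work) : Cmd Alph Reg :=
  .doWhile
    (.block
      (.pop (.work x) (fun v s => { v with cur := s })
        (.branch (fun v => v.cur == some true)
          (.pop (.work .tmp) (fun v s => { v with aux := s })
            (.push (.work .wire) (fun v => v.aux.getD false) .halt))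
          .halt)))
    fun v => v.cur == some true

/-- Read the value of the wire whose number is on the work stack `x` in unary: move all wires to the
scratch stack, move those before the wanted one back, note its value, and move the rest back. -/
def access (x : Work) : Cmd Alph Reg :=
  .seq (move .wire .tmp) <| .seq (skip x) <|
    .seq
      (.block
        (.pop (.work .tmp) (fun v s => { v with a := s.getD false, b := v.a })
          (.push (.work .wire) (fun v => v.a) .halt)))
      (move .tmp .wire)

/-- Read a gate and append its value to the wires. -/
def readGate : Cmd Alph Reg :=
  .seq
    (.block
      (.pop (.work .code) (fun v s => { v with bits := (s == some true, false) })
        (.branch (fun v => v.bits.1) .halt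
          (.pop (.work .code) (fun v s => { v with bits := (false, s == some true) }) .halt)))) <|
  .seq (access .code) <|
  .seq (.ite (fun v => v.bits.1 || v.bits.2) (access .code) (.block .halt))
    (.block
      (.push (.work .wire)
        (fun v => bif v.bits.1 then v.b || v.a else bif v.bits.2 then v.b && v.a else !v.a) .halt))

/-- Read all the gates. -/
def readGates : Cmd Alph Reg :=
  .doWhile
    (.seq (.block (.pop (.work .code) (fun v s => { v with more := s == some true }) .halt))
      (.ite (fun v => v.more) readGate (.block .halt)))
    fun v => v.more

/-- Compare the parameter with the number of absent variables. -/
def compareCount : Cmd Alph Reg :=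
  .doWhile
    (.block
      (.pop (.work .code) (fun v s => { v with lt := s.isSome })
        (.pop (.work .cnt) (fun v s => { v with gt := s.isSome }) .halt)))
    fun v => v.lt && v.gt

/-- The oracle machine, which returns the value of `fin` on the register collected. -/
def oracle (fin : Reg → Bool) : Cmd Alph Reg :=
  .seq split <| .seq (move .tmp .code) <| .seq (move .idx .vec) <| .seq readVars <|
  .seq readRest <| .seq readOut <| .seq readGates <| .seq compareCount <| .seq (clear .code) <|
  .seq (clear .cnt) <| .seq (access .idx) <| .seq (clear .wire) <|
    .block (.push .out fin (.load (fun _ => Reg.init) .halt))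

/-! ### Runs of the subprograms -/

open Cmd

variable (i : List (Bool ⊕ Bool)) (o : List Bool)

theorem exec_clear (v : Reg) (w : Work → List Bool) (x : Work) :
    Exec (clear x) v (stk i o w) { v with cur := none } (stk i o (Function.update w x []))
      (2 * (w x).length + 2) := by
  generalize hl : w x = l
  induction l generalizing v w with
  | nil =>
    refine .block_done rfl ?_ rfl (by simp)
    simp [hl]
  | cons s l ih =>
    have h := ih { v with cur := some s } (Function.update w x l) (by simp)
    rw [Function.update_idem] at h
    refine .block_next rfl ?_ rfl h (by simp; omega)
    simp [hl]

theorem exec_move (v : Reg) (w : Work → List Bool) (x y : Work) (hxy : x ≠ y) :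
    Exec (move x y) v (stk i o w) { v with cur := none }
      (stk i o (Function.update (Function.update w y ((w x).reverse ++ w y)) x []))
      (2 * (w x).length + 2) := by
  generalize hl : w x = l
  induction l generalizing v w with
  | nil =>
    refine .block_done rfl ?_ rfl (by simp)
    simp [hl]
  | cons s l ih =>
    have h1 := ih { v with cur := some s }
      (Function.update (Function.update w x l) y (s :: w y)) (by simp [hxy])
    have h2 : Function.update (Function.update (Function.update (Function.update w x l) y (s :: w y))
        y (l.reverse ++ (Function.update (Function.update w x l) y (s :: w y)) y)) x [] =
        Function.update (Function.update w y ((s :: l).reverse ++ w y)) x [] := by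
      rw [Function.update_self, Function.update_idem, Function.update_comm hxy,
        Function.update_idem]
      simp
    rw [h2] at h1
    refine .block_next rfl ?_ rfl h1 (by simp; omega)
    simp [hl, hxy.symm]

theorem exec_split (v : Reg) (x y c u t d n : List Bool) :
    Exec split v (stk (x.map Sum.inl ++ y.map Sum.inr) o (work c [] u t d n))
      { v with cur := none, more := false }
      (stk [] o (work c [] u (x.reverse ++ t) (y.reverse ++ d) n))
      (2 * (x.length + y.length) + 2) := by
  induction x generalizing v t with
  | nil =>
    induction y generalizing v d with
    | nil =>
      refine .block_done rfl ?_ rfl (by simp)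
      simp
    | cons s y ih =>
      rw [List.reverse_cons, List.append_assoc]
      refine .block_next rfl ?_ rfl (ih (s :: d) { v with cur := some s, more := false })
        (by simp; omega)
      simp [work]
  | cons s x ih =>
    rw [List.reverse_cons, List.append_assoc]
    refine .block_next rfl ?_ rfl (ih { v with cur := some s, more := true } (s :: t))
      (by simp; omega)
    simp [work]

theorem exec_readVars (v : Reg) (x r c u t d n : List Bool) :
    ∃ a, Exec readVars v
      (stk i o (work (unaryCode x.length ++ c) (x ++ r) u t d n))
      { v with cur := some false, aux := a, seen := v.seen || x.any id }
      (stk i o (work c r ((x.map not).reverse ++ u) t d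
        (List.replicate (x.countP not) true ++ n)))
      (2 * x.length + 2) := by
  induction x generalizing v u n with
  | nil =>
    refine ⟨v.aux, .block_done rfl ?_ rfl (by simp)⟩
    simp [work, unaryCode]
  | cons s x ih =>
    cases s with
    | true =>
      obtain ⟨a, h⟩ := ih { v with cur := some true, aux := some true, seen := true }
        (false :: u) n
      have e1 : (List.map not (true :: x)).reverse ++ u = (x.map not).reverse ++ false :: u := by
        simp
      have e2 : (true :: x).countP not = x.countP not := by simp
      have e3 : (v.seen || (true :: x).any id) = (true || x.any id) := by simp
      rw [e1, e2, e3]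
      refine ⟨a, .block_next rfl ?_ rfl h (by simp; omega)⟩
      simp [work, List.replicate_succ, unaryCode]
    | false =>
      obtain ⟨a, h⟩ := ih { v with cur := some true, aux := some false }
        (true :: u) (true :: n)
      have e1 : (List.map not (false :: x)).reverse ++ u = (x.map not).reverse ++ true :: u := by
        simp
      have e2 : List.replicate ((false :: x).countP not) true ++ n =
          List.replicate (x.countP not) true ++ true :: n := by
        simp [List.replicate_succ']
      rw [e1, e2]
      refine ⟨a, .block_next rfl ?_ rfl h (by simp; omega)⟩
      have e3 : (some false != some true) = true := rfl
      simp [work, List.replicate_succ, unaryCode, e3]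

theorem exec_readRest (v : Reg) (r c u t d n : List Bool) :
    Exec readRest v (stk i o (work c r u t d n))
      { v with cur := none, seen := v.seen || r.any id, pad := v.pad || r.any id }
      (stk i o (work c [] u t d n)) (2 * r.length + 2) := by
  induction r generalizing v with
  | nil =>
    refine .block_done rfl ?_ rfl (by simp)
    simp [work]
  | cons s r ih =>
    have h := ih { v with cur := some s, seen := v.seen || s, pad := v.pad || s }
    simp only [Bool.or_assoc] at h
    refine .block_next rfl ?_ rfl h (by simp; omega)
    cases s <;> simp [work]

theorem exec_readOut (v : Reg) (k : ℕ) (c r u t d n : List Bool) :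
    Exec readOut v (stk i o (work (unaryCode k ++ c) r u t d n)) { v with cur := some false }
      (stk i o (work c r u t (List.replicate k true ++ d) n)) (2 * k + 2) := by
  induction k generalizing v d with
  | zero =>
    refine .block_done rfl ?_ rfl (by simp)
    simp [work, unaryCode]
  | succ k ih =>
    have e : List.replicate (k + 1) true ++ d = List.replicate k true ++ true :: d := by
      simp [List.replicate_succ']
    rw [e]
    refine .block_next rfl ?_ rfl (ih { v with cur := some true } (true :: d)) (by omega)
    simp [work, unaryCode, List.replicate_succ]

/-- The number on the stack `x` is ended by a symbol `false` or by the bottom of the stack. -/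
theorem exec_skip (v : Reg) (w : Work → List Bool) (x : Work) (hx : x ≠ .tmp) (hx' : x ≠ .wire)
    (t₁ t₂ r : List Bool) (ht : w .tmp = t₁ ++ t₂) (hr : r.head? ≠ some true)
    (hw : w x = List.replicate t₁.length true ++ r) :
    ∃ a, Exec (skip x) v (stk i o w) { v with cur := r.head?, aux := a }
      (stk i o (Function.update (Function.update (Function.update w x r.tail) .tmp t₂) .wire
        (t₁.reverse ++ w .wire))) (2 * t₁.length + 2) := by
  induction t₁ generalizing v w with
  | nil =>
    have e : Function.update (Function.update (Function.update w x r.tail) .tmp t₂) .wire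
        ([].reverse ++ w .wire) = Function.update w x r.tail := by
      funext j
      simp only [Function.update_apply]
      split_ifs <;> simp_all
    rw [e]
    have hr' : (r.head? == some true) = false := by simpa using hr
    refine ⟨v.aux, .block_done rfl ?_ (by simpa using hr) (by simp)⟩
    simp [hw, hr']
  | cons s t₁ ih =>
    obtain ⟨a, h⟩ := ih { v with cur := some true, aux := some s }
      (Function.update (Function.update (Function.update w x
        (List.replicate t₁.length true ++ r)) .tmp (t₁ ++ t₂)) .wire (s :: w .wire))
      (by simp) (by simp [hx, hx'])
    have e : Function.update (Function.update (Function.update (Function.update (Function.update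
        (Function.update w x (List.replicate t₁.length true ++ r)) .tmp (t₁ ++ t₂)) .wire
        (s :: w .wire)) x r.tail) .tmp t₂) .wire (t₁.reverse ++ Function.update (Function.update
        (Function.update w x (List.replicate t₁.length true ++ r)) .tmp (t₁ ++ t₂)) .wire
        (s :: w .wire) .wire) = Function.update (Function.update (Function.update w x r.tail)
        .tmp t₂) .wire ((s :: t₁).reverse ++ w .wire) := by
      funext j
      simp only [Function.update_apply]
      split_ifs <;> simp_all
    rw [e] at h
    refine ⟨a, .block_next rfl ?_ rfl h (by simp; omega)⟩
    simp [hw, ht, hx.symm, hx'.symm, List.replicate_succ]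

theorem exec_access (v : Reg) (w : Work → List Bool) (x : Work) (hx : x ≠ .tmp) (hx' : x ≠ .wire)
    (ws : List Bool) (j : ℕ) (hj : j < ws.length) (r : List Bool) (hr : r.head? ≠ some true)
    (hw : w x = List.replicate j true ++ r) (hws : w .wire = ws.reverse) (ht : w .tmp = []) :
    ∃ a, Exec (access x) v (stk i o w)
      { v with cur := none, aux := a, a := ws.getD j false, b := v.a }
      (stk i o (Function.update w x r.tail)) (4 * ws.length + 7) := by
  obtain ⟨t₁, s, t₂, rfl, rfl⟩ : ∃ t₁ s t₂, ws = t₁ ++ s :: t₂ ∧ j = t₁.length :=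
    ⟨ws.take j, ws[j], ws.drop (j + 1), by simp, by simp; omega⟩
  have h1 := exec_move i o v w .wire .tmp (by decide)
  rw [hws, ht, List.reverse_reverse, List.append_nil] at h1
  obtain ⟨a, h2⟩ := exec_skip i o { v with cur := none } (Function.update (Function.update w .tmp
    (t₁ ++ s :: t₂)) .wire []) x hx hx' t₁ (s :: t₂) r (by simp) hr (by simp [hx, hx', hw])
  have h3 : Exec (.block
        (.pop (.work .tmp) (fun v s => { v with a := s.getD false, b := v.a })
          (.push (.work .wire) (fun v => v.a) .halt)))
      { v with cur := r.head?, aux := a }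
      (stk i o (Function.update (Function.update (Function.update (Function.update (Function.update
        w .tmp (t₁ ++ s :: t₂)) .wire []) x r.tail) .tmp (s :: t₂)) .wire (t₁.reverse ++
        (Function.update (Function.update w .tmp (t₁ ++ s :: t₂)) .wire []) .wire)))
      { v with cur := r.head?, aux := a, a := s, b := v.a }
      (stk i o (Function.update (Function.update (Function.update w x r.tail) .tmp t₂) .wire
        (s :: t₁.reverse))) 1 := by
    refine .block ?_
    simp only [TM2.stepAux, stk_work, update_stk_work, TM2.Cfg.mk.injEq, true_and]
    refine ⟨by simp, ?_⟩
    congr 1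
    funext j
    simp only [Function.update_apply]
    split_ifs <;> simp_all
  have h4 := exec_move i o { v with cur := r.head?, aux := a, a := s, b := v.a }
    (Function.update (Function.update (Function.update w x r.tail) .tmp t₂) .wire
        (s :: t₁.reverse)) .tmp .wire (by decide)
  have e : Function.update (Function.update (Function.update (Function.update (Function.update w x
      r.tail) .tmp t₂) .wire (s :: t₁.reverse)) .wire ((Function.update (Function.update
      (Function.update w x r.tail) .tmp t₂) .wire (s :: t₁.reverse) .tmp).reverse ++
      Function.update (Function.update (Function.update w x r.tail) .tmp t₂) .wire
      (s :: t₁.reverse) .wire)) .tmp [] = Function.update w x r.tail := by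
    funext j
    simp only [Function.update_apply]
    split_ifs <;> simp_all
  rw [e] at h4
  have e' : (t₁ ++ s :: t₂).getD t₁.length false = s := by simp
  rw [e']
  refine ⟨a, (h1.seq (h2.seq (h3.seq h4))).mono ?_⟩
  simp
  omega

theorem exec_accessCode (v : Reg) (ws c d n : List Bool) (j : ℕ) (hj : j < ws.length) :
    ∃ a, Exec (access .code) v (stk i o (work (unaryCode j ++ c) [] ws.reverse [] d n))
      { v with cur := none, aux := a, a := ws.getD j false, b := v.a }
      (stk i o (work c [] ws.reverse [] d n)) (4 * ws.length + 7) := by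
  obtain ⟨a, h⟩ := exec_access i o v (work (unaryCode j ++ c) [] ws.reverse [] d n) .code
    (by decide) (by decide) ws j hj (false :: c) (by simp) (by simp [work, unaryCode]) rfl rfl
  rw [update_work_code] at h
  exact ⟨a, h⟩

theorem exec_readGate (v : Reg) (g : Gate) (ws c d n : List Bool)
    (hg : ∀ j ∈ g.args, j < ws.length) :
    ∃ v', Exec readGate v (stk i o (work (g.code ++ c) [] ws.reverse [] d n)) v'
      (stk i o (work c [] (ws ++ [g.eval ws]).reverse [] d n)) (8 * ws.length + 17) ∧
      v'.more = v.more ∧ v'.seen = v.seen ∧ v'.pad = v.pad := by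
  cases g with
  | not j =>
    obtain ⟨a, h1⟩ := exec_accessCode i o { v with bits := (false, false) } ws c d n j
      (hg j (by simp [Gate.args]))
    refine ⟨{ v with
      bits := (false, false), cur := none, aux := a, a := ws.getD j false, b := v.a },
      (Exec.seq (.block (v' := { v with bits := (false, false) })
      (S' := stk i o (work (unaryCode j ++ c) [] ws.reverse [] d n)) ?_) (h1.seq
      (Exec.seq (.ite_false rfl (.block rfl)) (.block (S' := stk i o
        (work c [] (ws ++ [(Gate.not j).eval ws]).reverse [] d n)) ?_)))).mono (by omega), rfl, rfl, rfl⟩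
    · simp [work, Gate.code]
    · simp [work, Gate.eval]
  | and j k =>
    obtain ⟨a, h1⟩ := exec_accessCode i o { v with bits := (false, true) } ws
      (unaryCode k ++ c) d n j (hg j (by simp [Gate.args]))
    obtain ⟨a', h2⟩ := exec_accessCode i o
      { v with bits := (false, true), cur := none, aux := a, a := ws.getD j false, b := v.a }
      ws c d n k (hg k (by simp [Gate.args]))
    refine ⟨{ v with
      bits := (false, true), cur := none, aux := a', a := ws.getD k false,
      b := ws.getD j false },
      (Exec.seq (.block (v' := { v with bits := (false, true) })
      (S' := stk i o (work (unaryCode j ++ (unaryCode k ++ c)) [] ws.reverse [] d n)) ?_) (h1.seq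
      (Exec.seq (.ite_true rfl h2) (.block (S' := stk i o
        (work c [] (ws ++ [(Gate.and j k).eval ws]).reverse [] d n)) ?_)))).mono (by omega), rfl, rfl, rfl⟩
    · simp [work, Gate.code]
    · simp [work, Gate.eval]
  | or j k =>
    obtain ⟨a, h1⟩ := exec_accessCode i o { v with bits := (true, false) } ws
      (unaryCode k ++ c) d n j (hg j (by simp [Gate.args]))
    obtain ⟨a', h2⟩ := exec_accessCode i o
      { v with bits := (true, false), cur := none, aux := a, a := ws.getD j false, b := v.a }
      ws c d n k (hg k (by simp [Gate.args]))
    refine ⟨{ v with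
      bits := (true, false), cur := none, aux := a', a := ws.getD k false,
      b := ws.getD j false },
      (Exec.seq (.block (v' := { v with bits := (true, false) })
      (S' := stk i o (work (unaryCode j ++ (unaryCode k ++ c)) [] ws.reverse [] d n)) ?_) (h1.seq
      (Exec.seq (.ite_true rfl h2) (.block (S' := stk i o
        (work c [] (ws ++ [(Gate.or j k).eval ws]).reverse [] d n)) ?_)))).mono (by omega), rfl, rfl, rfl⟩
    · simp [work, Gate.code]
    · simp [work, Gate.eval]

/-- Each gate costs time linear in the number of wires, which is at most `B`. -/
theorem exec_readGates (v : Reg) (gs : List Gate) (ws c d n : List Bool) (B : ℕ)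
    (hB : ws.length + gs.length ≤ B)
    (hg : ∀ (k : ℕ) (hk : k < gs.length), ∀ j ∈ gs[k].args, j < ws.length + k) :
    ∃ v', Exec readGates v (stk i o (work (Circuit.gatesCode gs ++ c) [] ws.reverse [] d n)) v'
      (stk i o (work c [] (gs.foldl (fun w g => w ++ [g.eval w]) ws).reverse [] d n))
      (gs.length * (8 * B + 20) + 4) ∧ v'.seen = v.seen ∧ v'.pad = v.pad := by
  induction gs generalizing v ws with
  | nil =>
    refine ⟨{ v with more := false }, Exec.mono (.done (.seq (.block ?_)
      (.ite_false rfl (.block rfl))) rfl) (by omega), rfl, rfl⟩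
    simp [work, Circuit.gatesCode]
  | cons g gs ih =>
    obtain ⟨v₁, h1, hm, hs, hp⟩ := exec_readGate i o { v with more := true } g ws
      (Circuit.gatesCode gs ++ c) d n (fun j hj => hg 0 (by simp) j hj)
    simp only [List.length_cons] at hB
    obtain ⟨v₂, h2, hs', hp'⟩ := ih v₁ (ws ++ [g.eval ws])
      (by simp only [List.length_append, List.length_singleton]; omega) (by
      intro k hk j hj
      have := hg (k + 1) (by simpa using hk) j (by simpa using hj)
      simp only [List.length_append, List.length_singleton]
      omega)
    have h3 : Exec (.block (.pop (.work .code) (fun v s => { v with more := s == some true }) .halt))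
        v (stk i o (work (Circuit.gatesCode (g :: gs) ++ c) [] ws.reverse [] d n))
        { v with more := true }
        (stk i o (work (g.code ++ (Circuit.gatesCode gs ++ c)) [] ws.reverse [] d n)) 1 := by
      refine .block ?_
      simp [work, Circuit.gatesCode]
    have h4 := Exec.next (b := fun v : Reg => v.more)
      (h3.seq (.ite_true (d := .block .halt) (b := fun v : Reg => v.more) rfl h1)) hm h2
    refine ⟨v₂, h4.mono ?_, hs'.trans hs, hp'.trans hp⟩
    rw [List.length_cons, Nat.add_mul]
    omega

/-- The loop removes a mark from each of the two counts until one of them is exhausted; the leftovers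
are bounded by the original counts. -/
theorem exec_compareCount (v : Reg) (k m : ℕ) (r u t d : List Bool) :
    ∃ k' m', k' ≤ k ∧ m' ≤ m ∧
    Exec compareCount v
      (stk i o (work (List.replicate k true) r u t d (List.replicate m true)))
      { v with lt := decide (m < k), gt := decide (k < m) }
      (stk i o (work (List.replicate k' true) r u t d (List.replicate m' true))) (2 * k + 2) := by
  induction k generalizing v m with
  | zero =>
    refine ⟨0, m - 1, le_rfl, by omega, .block_done rfl ?_ (by simp) (by simp)⟩
    cases m <;> simp [work, List.replicate_succ]
  | succ k ih =>
    cases m with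
    | zero =>
      refine ⟨k, 0, by omega, le_rfl, .block_done rfl ?_ (by simp) (by simp)⟩
      simp [work, List.replicate_succ]
    | succ m =>
      obtain ⟨k', m', hk, hm, h⟩ := ih { v with lt := true, gt := true } m
      refine ⟨k', m', by omega, by omega, ?_⟩
      simp only [Nat.add_lt_add_iff_right]
      refine .block_next rfl ?_ rfl h (by omega)
      simp [work, List.replicate_succ]

theorem length_wires (C : Circuit) (y : Fin C.numVars → Bool) :
    (C.wires y).length = C.numVars + C.gates.length := by
  have h : ∀ (l : List Gate) (w : List Bool),
      (l.foldl (fun w g => w ++ [g.eval w]) w).length = w.length + l.length := by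
    intro l
    induction l with
    | nil => simp
    | cons g l ih => intro w; simp [ih]; omega
  rw [Circuit.wires, h, List.length_ofFn]

theorem length_gates_lt (gs : List Gate) : gs.length < (Circuit.gatesCode gs).length := by
  induction gs with
  | nil => simp [Circuit.gatesCode]
  | cons g gs ih => simp [Circuit.gatesCode] at ih ⊢; omega

/-- The code of a circuit is longer than its number of wires and the number of its output wire
together. -/
theorem numVars_add_lt (C : Circuit) : C.numVars + C.out + C.gates.length + 2 < C.code.length := by
  have h := length_gates_lt C.gates
  simp [Circuit.code, unaryCode]
  omega

/-- The oracle machine, on a circuit `C`, a parameter `k`, the characteristic vector `x` of the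
present variables and the characteristic vector `r` of the other elements: the value of `C` and the
count are those of the absent variables. -/
theorem exec_oracle (fin : Reg → Bool) (f : Bool → Bool → Bool → Bool → Bool → Bool)
    (hf : ∀ v, fin v = f v.seen v.pad v.lt v.gt v.a) (C : Circuit) (k : ℕ)
    (y : Fin C.numVars → Bool) (x r : List Bool) (hx : x.map not = List.ofFn y) (L : ℕ)
    (hL : C.code.length + k ≤ L) (hL' : x.length + r.length ≤ L) :
    Exec (oracle fin) Reg.init
      (Cmd.single .inp ((C.code ++ List.replicate k true).map Sum.inl ++ (x ++ r).map Sum.inr))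
      Reg.init
      (Cmd.single .out [f ((x ++ r).any id) (r.any id) (decide (x.countP not < k))
        (decide (k < x.countP not)) (C.eval y)])
      (8 * L * L + 60 * L + 60) := by
  have hn : x.length = C.numVars := by
    have := congrArg List.length hx
    simpa using this
  have hw := numVars_add_lt C
  have e0 : ∀ l : List (Bool ⊕ Bool),
      (Cmd.single .inp l : ∀ k, List (Alph k)) = stk l [] (work [] [] [] [] [] []) := by
    intro l
    funext j
    rcases j with _ | _ | _ | _ <;> rfl
  have e1 : ∀ l : List Bool,
      (Cmd.single .out l : ∀ k, List (Alph k)) = stk [] l (work [] [] [] [] [] []) := by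
    intro l
    funext j
    rcases j with _ | _ | _ | _ <;> rfl
  rw [e0, e1]
  have h1 := exec_split [] Reg.init (C.code ++ List.replicate k true) (x ++ r) [] [] [] [] []
  have h2 := exec_move [] [] { Reg.init with cur := none, more := false }
    (work [] [] [] ((C.code ++ List.replicate k true).reverse ++ []) ((x ++ r).reverse ++ []) [])
    .tmp .code (by decide)
  have h3 := exec_move [] [] { Reg.init with cur := none, more := false }
    (work (C.code ++ List.replicate k true) [] [] [] ((x ++ r).reverse ++ []) [])
    .idx .vec (by decide)
  simp only [work, List.append_nil, List.reverse_reverse, update_work_code, update_work_tmp,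
    update_work_vec, update_work_idx] at h1 h2 h3
  have ec : C.code ++ List.replicate k true = unaryCode x.length ++ (unaryCode C.out ++
      (Circuit.gatesCode C.gates ++ List.replicate k true)) := by
    simp [Circuit.code, hn]
  obtain ⟨a, h4⟩ := exec_readVars [] [] { Reg.init with cur := none, more := false } x r
    (unaryCode C.out ++ (Circuit.gatesCode C.gates ++ List.replicate k true)) [] [] [] []
  rw [← ec] at h4
  have h5 := exec_readRest [] []
    { Reg.init with cur := some false, more := false, aux := a, seen := x.any id } r
    (unaryCode C.out ++ (Circuit.gatesCode C.gates ++ List.replicate k true))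
    ((x.map not).reverse ++ []) [] [] (List.replicate (x.countP not) true ++ [])
  have h6 := exec_readOut [] []
    { Reg.init with cur := none, more := false, aux := a, seen := x.any id || r.any id,
                    pad := r.any id } C.out
    (Circuit.gatesCode C.gates ++ List.replicate k true) []
    ((x.map not).reverse ++ []) [] [] (List.replicate (x.countP not) true ++ [])
  obtain ⟨v, h7, hs, hp⟩ := exec_readGates [] []
    { Reg.init with cur := some false, more := false, aux := a, seen := x.any id || r.any id,
                    pad := r.any id } C.gates (x.map not)
    (List.replicate k true) (List.replicate C.out true ++ [])
    (List.replicate (x.countP not) true ++ []) L (by simp; omega) (by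
      intro j hj i hi
      have := C.args_lt j hj i hi
      simpa [hn] using this)
  obtain ⟨k', m', hk, hm, h8⟩ := exec_compareCount [] [] v k (x.countP not) []
    (C.gates.foldl (fun w g => w ++ [g.eval w]) (x.map not)).reverse []
    (List.replicate C.out true)
  have h9 := exec_clear [] []
    { v with lt := decide (x.countP not < k), gt := decide (k < x.countP not) }
    (work (List.replicate k' true) []
      (C.gates.foldl (fun w g => w ++ [g.eval w]) (x.map not)).reverse []
      (List.replicate C.out true) (List.replicate m' true)) .code
  have h10 := exec_clear [] []
    { v with lt := decide (x.countP not < k), gt := decide (k < x.countP not), cur := none }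
    (work [] [] (C.gates.foldl (fun w g => w ++ [g.eval w]) (x.map not)).reverse []
      (List.replicate C.out true) (List.replicate m' true)) .cnt
  have hlen := length_wires C y
  obtain ⟨a', h11⟩ := exec_access [] []
    { v with lt := decide (x.countP not < k), gt := decide (k < x.countP not), cur := none }
    (work [] [] (C.wires y).reverse [] (List.replicate C.out true) []) .idx
    (by decide) (by decide) (C.wires y) C.out (by rw [hlen]; exact C.out_lt) [] (by simp)
    (by simp [work]) rfl rfl
  have h12 := exec_clear [] []
    { v with lt := decide (x.countP not < k), gt := decide (k < x.countP not), cur := none,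
             aux := a', a := (C.wires y).getD C.out false, b := v.a }
    (work [] [] (C.wires y).reverse [] [] []) .wire
  have ew : C.gates.foldl (fun w g => w ++ [g.eval w]) (x.map not) = C.wires y := by
    rw [Circuit.wires, hx]
  rw [ew] at h7 h8 h9 h10
  simp only [List.append_nil, work, update_work_code, update_work_cnt, update_work_idx,
    update_work_wire, List.tail_nil] at h4 h5 h6 h7 h8 h9 h10 h11 h12
  have h13 : Exec (.block (.push .out fin (.load (fun _ => Reg.init) .halt)))
      { v with lt := decide (x.countP not < k), gt := decide (k < x.countP not), cur := none,
               aux := a', a := (C.wires y).getD C.out false, b := v.a }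
      (stk [] [] (work [] [] [] [] [] [])) Reg.init
      (stk [] [f ((x ++ r).any id) (r.any id) (decide (x.countP not < k))
        (decide (k < x.countP not)) (C.eval y)] (work [] [] [] [] [] [])) 1 := by
    refine .block ?_
    simp [hf, hs, hp, Circuit.eval]
  refine (h1.seq <| h2.seq <| h3.seq <| h4.seq <| h5.seq <| h6.seq <| h7.seq <| h8.seq <| h9.seq <|
    h10.seq <| h11.seq <| h12.seq h13).mono ?_
  have hc : x.countP not ≤ x.length := List.countP_le_length
  have hg : C.gates.length * (8 * L + 20) ≤ L * (8 * L + 20) :=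
    Nat.mul_le_mul_right _ (by omega)
  have hg' : L * (8 * L + 20) = 8 * L * L + 20 * L := by ring
  simp only [List.length_append, List.length_reverse, List.length_replicate, hlen]
  omega

end Oracle

/-! ### Two set systems -/

/-- The sets that miss at least `k` elements of `V`, together with the empty set, form a matroid: if
`k ≤ |V|`, the elements outside `V` are coloops and the rest is uniform. -/
theorem isMatroid_missing {n : ℕ} (V : Finset (Fin n)) (k : ℕ) :
    IsMatroid {X : Finset (Fin n) | X = ∅ ∨ k ≤ (V \ X).card} := by
  refine ⟨Or.inl rfl, ?_, ?_⟩
  · rintro X (rfl | hX) Y hY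
    · exact Or.inl (Finset.subset_empty.1 hY)
    · exact Or.inr (hX.trans (Finset.card_le_card (Finset.sdiff_subset_sdiff le_rfl hY)))
  · intro X hX Y hY hlt
    have hX' : k ≤ (V \ X).card := by
      rcases hX with rfl | hX
      · simp at hlt
      · exact hX
    by_cases h : ∃ x ∈ X \ Y, x ∉ V
    · obtain ⟨x, hx, hxV⟩ := h
      refine ⟨x, hx, Or.inr ?_⟩
      have e : V \ insert x Y = V \ Y := by
        ext z
        simp only [Finset.mem_sdiff, Finset.mem_insert, not_or]
        refine ⟨fun h => ⟨h.1, h.2.2⟩, fun h => ⟨h.1, ?_, h.2⟩⟩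
        rintro rfl
        exact hxV h.1
      rw [e]
      rcases hY with rfl | hY
      · exact hX'.trans (Finset.card_le_card (Finset.sdiff_subset_sdiff le_rfl (by simp)))
      · exact hY
    · push Not at h
      obtain ⟨x, hx⟩ : (X \ Y).Nonempty := by
        rw [Finset.nonempty_iff_ne_empty, Ne, Finset.sdiff_eq_empty_iff_subset]
        exact fun h => absurd (Finset.card_le_card h) (by omega)
      refine ⟨x, hx, Or.inr (hX'.trans ?_)⟩
      -- Outside `V` the set `X` is contained in `Y`, so inside `V` it is larger than `Y`.
      have h1 : (X \ V).card ≤ (Y \ V).card := by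
        refine Finset.card_le_card fun z hz => ?_
        rw [Finset.mem_sdiff] at hz ⊢
        refine ⟨?_, hz.2⟩
        by_contra hzY
        exact hz.2 (h z (Finset.mem_sdiff.2 ⟨hz.1, hzY⟩))
      have h2 := Finset.card_sdiff_add_card_inter X V
      have h3 := Finset.card_sdiff_add_card_inter Y V
      have h4 := Finset.card_sdiff_add_card_inter V X
      have h5 := Finset.card_sdiff_add_card_inter V Y
      rw [Finset.inter_comm] at h4 h5
      have h6 : V \ insert x Y = (V \ Y).erase x := by
        ext z
        simp only [Finset.mem_sdiff, Finset.mem_insert, not_or, Finset.mem_erase]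
        tauto
      have h7 : x ∈ V \ Y := Finset.mem_sdiff.2 ⟨h x hx, (Finset.mem_sdiff.1 hx).2⟩
      rw [h6, Finset.card_erase_of_mem h7]
      omega

/-- If the elements outside `V` can be added only when `φ` holds, and `φ` is monotone in the trace
on `V`, the resulting set system is a greedoid. -/
theorem isGreedoid_locked {n : ℕ} (V : Finset (Fin n)) (φ : Finset (Fin n) → Prop)
    (hφ : ∀ X Y, V \ Y ⊆ V \ X → φ X → φ Y) :
    IsGreedoid {X : Finset (Fin n) | X ⊆ V ∨ φ X} := by
  refine ⟨Or.inl (Finset.empty_subset _), fun X hX Y hY hlt => ?_⟩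
  by_cases h : ∃ x ∈ X \ Y, x ∈ V
  · obtain ⟨x, hx, hxV⟩ := h
    refine ⟨x, hx, ?_⟩
    rcases hY with hY | hY
    · exact Or.inl (Finset.insert_subset hxV hY)
    · exact Or.inr (hφ _ _ (Finset.sdiff_subset_sdiff le_rfl (Finset.subset_insert _ _)) hY)
  · push Not at h
    obtain ⟨x, hx⟩ : (X \ Y).Nonempty := by
      rw [Finset.nonempty_iff_ne_empty, Ne, Finset.sdiff_eq_empty_iff_subset]
      exact fun h => absurd (Finset.card_le_card h) (by omega)
    refine ⟨x, hx, Or.inr ?_⟩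
    have hφX : φ X := hX.resolve_left fun hXV => h x hx (hXV (Finset.mem_sdiff.1 hx).1)
    refine hφ X _ (fun z hz => ?_) hφX
    simp only [Finset.mem_sdiff, Finset.mem_insert, not_or] at hz ⊢
    exact ⟨hz.1, fun hzX => h z (Finset.mem_sdiff.2 ⟨hzX, hz.2.2⟩) hz.1⟩

/-! ### The families attached to weighted circuits -/

theorem Circuit.code_append_inj {C D : Circuit} {s t : List Bool}
    (h : C.code ++ s = D.code ++ t) : C = D ∧ s = t := by
  have hg : ∀ (l m : List Gate), gatesCode l ++ s = gatesCode m ++ t → l = m ∧ s = t := by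
    intro l
    induction l with
    | nil =>
      intro m h
      cases m <;> simp_all [gatesCode]
    | cons a l ih =>
      intro m h
      cases m with
      | nil => simp [gatesCode] at h
      | cons b m =>
        have h2 : a.code ++ (gatesCode l ++ s) = b.code ++ (gatesCode m ++ t) := by
          simpa [gatesCode] using h
        obtain ⟨rfl, h3⟩ := Gate.code_append_inj h2
        obtain ⟨rfl, h4⟩ := ih m h3
        exact ⟨rfl, h4⟩
  simp only [Circuit.code, List.append_assoc] at h
  obtain ⟨h1, h⟩ := unaryCode_append_inj h
  obtain ⟨h2, h⟩ := unaryCode_append_inj h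
  obtain ⟨h3, h⟩ := hg _ _ h
  exact ⟨Circuit.ext h1 h3 h2, h⟩

/-- The indices are the pairs of a circuit and a weight; the code is that of the circuit, followed
by the weight in unary, and the domain has as many elements as the code has bits. -/
def circuitDomains : IndexedDomains where
  H := Circuit × ℕ
  code h := h.1.code ++ List.replicate h.2 true
  code_injective := by
    rintro ⟨C, k⟩ ⟨D, l⟩ h
    obtain ⟨rfl, h⟩ := Circuit.code_append_inj h
    have := congrArg List.length h
    simp at this
    rw [this]
  size h := (h.1.code ++ List.replicate h.2 true).length

namespace circuitDomains

variable (h : Circuit × ℕ)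

theorem numVars_add_lt_size : h.1.numVars + h.2 < circuitDomains.size h := by
  have := Oracle.numVars_add_lt h.1
  simp [circuitDomains]
  omega

/-- The variables of the circuit, as the first elements of the domain. -/
def varEmb : Fin h.1.numVars ↪ Fin (circuitDomains.size h) :=
  Fin.castLEEmb ((Nat.le_add_right _ _).trans (numVars_add_lt_size h).le)

/-- The elements of the domain that are variables. -/
def vars : Finset (Fin (circuitDomains.size h)) := Finset.univ.map (varEmb h)

variable {h}

theorem mem_vars {i : Fin (circuitDomains.size h)} : i ∈ vars h ↔ i.val < h.1.numVars := by
  simp only [vars, Finset.mem_map, Finset.mem_univ, true_and]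
  constructor
  · rintro ⟨j, rfl⟩
    exact j.2
  · intro hi
    exact ⟨⟨i, hi⟩, rfl⟩

/-- The assignment that sets the variables absent from `X` to true. -/
def absent (X : Finset (Fin (circuitDomains.size h))) : Fin h.1.numVars → Bool :=
  fun i => decide (varEmb h i ∉ X)

theorem vars_sdiff (X : Finset (Fin (circuitDomains.size h))) :
    vars h \ X = (Finset.univ.filter fun i => absent X i = true).map (varEmb h) := by
  ext z
  simp only [vars, absent, Finset.mem_sdiff, Finset.mem_map, Finset.mem_univ, true_and,
    Finset.mem_filter, decide_eq_true_eq]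
  constructor
  · rintro ⟨⟨i, rfl⟩, hi⟩
    exact ⟨i, hi, rfl⟩
  · rintro ⟨i, hi, rfl⟩
    exact ⟨⟨i, rfl⟩, hi⟩

theorem absent_congr {X Y : Finset (Fin (circuitDomains.size h))}
    (hXY : vars h \ X = vars h \ Y) : absent X = absent Y := by
  rw [vars_sdiff, vars_sdiff] at hXY
  have h1 := Finset.map_injective _ hXY
  funext i
  have h2 := Finset.ext_iff.1 h1 i
  simp only [Finset.mem_filter, Finset.mem_univ, true_and] at h2
  exact Bool.eq_iff_iff.2 h2

end circuitDomains

open circuitDomains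

/-- The sets from which at least `k` variables are absent, and the empty set. -/
def missingFamily : SetSystemFamily circuitDomains :=
  fun h => {X | X = ∅ ∨ h.2 ≤ (vars h \ X).card}

/-- The sets that consist of variables, or from which fewer than `k` variables are absent, or from
which exactly `k` variables are absent that satisfy the circuit. -/
def lockedFamily : SetSystemFamily circuitDomains :=
  fun h => {X | X ⊆ vars h ∨ ((vars h \ X).card < h.2 ∨
    (vars h \ X).card = h.2 ∧ h.1.eval (absent X) = true)}

theorem isMatroid_missingFamily (h : circuitDomains.H) : IsMatroid (missingFamily h) :=
  isMatroid_missing _ _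

theorem isGreedoid_lockedFamily (h : circuitDomains.H) : IsGreedoid (lockedFamily h) := by
  refine isGreedoid_locked _ _ fun X Y hXY hX => ?_
  have hle := Finset.card_le_card hXY
  rcases hX with hX | ⟨hX, hC⟩
  · exact Or.inl (hle.trans_lt hX)
  · rcases hle.lt_or_eq with hlt | heq
    · exact Or.inl (hX ▸ hlt)
    · have e := Finset.eq_of_subset_of_card_le hXY heq.ge
      exact Or.inr ⟨heq.trans hX, absent_congr e ▸ hC⟩

/-- A common set that misses exactly `k` elements contains an element that is not a variable, so it
misses exactly `k` variables, and these satisfy the circuit. -/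
theorem mem_weightedCircuitSat_iff (p : Circuit × ℕ) :
    p ∈ weightedCircuitSat.yes ↔
      (p, p.2) ∈ (dualIntersectionProblem missingFamily lockedFamily).yes := by
  have hsize := numVars_add_lt_size p
  constructor
  · rintro ⟨x, hx, hC⟩
    set T := (Finset.univ.filter fun i => x i = true).map (varEmb p) with hT
    have hTcard : T.card = p.2 := by rw [hT, Finset.card_map]; exact hx
    have ha : absent Tᶜ = x := by
      funext i
      rw [Bool.eq_iff_iff]
      simp [absent, hT]
    have hV : (vars p \ Tᶜ).card = p.2 := by
      rw [vars_sdiff, ha]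
      exact hTcard
    refine ⟨Tᶜ, ⟨Or.inr hV.ge, Or.inr (Or.inr ⟨hV, ?_⟩)⟩, ?_⟩
    · rw [ha]; exact hC
    · have h1 := Finset.card_compl_add_card T
      rw [Fintype.card_fin, hTcard] at h1
      exact h1
  · rintro ⟨X, ⟨hF, hG⟩, hX⟩
    change X.card + p.2 = circuitDomains.size p at hX
    have h1 : (vars p).card = p.1.numVars := by simp [vars]
    have hF' : p.2 ≤ (vars p \ X).card := by
      rcases hF with rfl | hF
      · simp at hX; omega
      · exact hF
    have hG' := hG.resolve_left fun hsub => by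
      have h2 : X.card ≤ (vars p).card := Finset.card_le_card hsub
      omega
    obtain ⟨hk, hC⟩ := hG'.resolve_left hF'.not_gt
    refine ⟨absent X, ?_, hC⟩
    rw [vars_sdiff, Finset.card_map] at hk
    exact hk

/-! ### Polynomial-time algorithms for the families -/

/-- Move the first stack onto the second one, with all symbols replaced by `true`. -/
def lengthCmd : Cmd (fun _ : Bool => Bool) Bool :=
  .doWhile
    (.block (.pop false (fun _ s => s.isSome)
      (.branch id (.push true (fun _ => true) .halt) .halt))) id

theorem exec_lengthCmd (v : Bool) (l a : List Bool) :
    Cmd.Exec lengthCmd v (fun i => bif i then a else l) false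
      (fun i => bif i then List.replicate l.length true ++ a else []) (2 * l.length + 2) := by
  induction l generalizing v a with
  | nil =>
    refine .block_done rfl ?_ rfl (by simp)
    simp
  | cons s l ih =>
    have e : List.replicate (s :: l).length true ++ a =
        List.replicate l.length true ++ true :: a := by
      simp [List.replicate_succ']
    rw [e]
    refine .block_next rfl ?_ rfl (ih true (true :: a)) (by simp; omega)
    simp
    funext i
    cases i <;> simp

theorem polyTime_circuitDomains : circuitDomains.PolyTime := by
  refine ⟨2 * Polynomial.X + 3, lengthCmd.computableWithin false true false fun h =>
    ⟨2 * (circuitDomains.code h).length + 2, ?_, by simp⟩⟩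
  have h1 := exec_lengthCmd false (circuitDomains.code h) []
  rw [List.append_nil] at h1
  have e1 : (fun i => bif i then [] else circuitDomains.code h) =
      (Cmd.single false (circuitDomains.code h) : ∀ _ : Bool, List Bool) := by
    funext i; cases i <;> rfl
  have e2 : (fun i => bif i then List.replicate (circuitDomains.code h).length true else []) =
      (Cmd.single true (List.replicate (circuitDomains.size h) true) : ∀ _ : Bool, List Bool) := by
    funext i; cases i <;> rfl
  rw [e1, e2] at h1
  exact h1

theorem countP_ofFn {n : ℕ} (y : Fin n → Bool) :
    (List.ofFn y).countP id = (Finset.univ.filter fun i => y i = true).card := by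
  induction n with
  | zero => simp
  | succ n ih =>
    rw [List.ofFn_succ, List.countP_cons, ih, Fin.card_filter_univ_succ]
    rcases Bool.eq_false_or_eq_true (y 0) with h | h <;> simp [h]

theorem any_drop_ofFn {n m : ℕ} (y : Fin n → Bool) :
    ((List.ofFn y).drop m).any id = true ↔ ∃ i : Fin n, m ≤ i.val ∧ y i = true := by
  rw [List.any_eq_true]
  constructor
  · rintro ⟨b, hb, rfl⟩
    obtain ⟨j, hj, hjb⟩ := List.mem_iff_getElem.1 hb
    rw [List.getElem_drop, List.getElem_ofFn] at hjb
    exact ⟨_, Nat.le_add_right m j, hjb⟩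
  · rintro ⟨i, hi, hy⟩
    refine ⟨true, List.mem_iff_getElem.2 ⟨i - m, by simp; omega, ?_⟩, rfl⟩
    rw [List.getElem_drop, List.getElem_ofFn, ← hy]
    congr 1
    ext
    simp
    omega

/-- A family over `circuitDomains` has a uniform polynomial-time oracle if membership depends only
on whether the set is empty, whether it consists of variables, how the number of absent variables
compares with the weight, and the value of the circuit at the absent variables. -/
theorem uniformPolyTimeOracle_of_iff (F : SetSystemFamily circuitDomains)
    (f : Bool → Bool → Bool → Bool → Bool → Bool)
    (hF : ∀ (h : Circuit × ℕ) (X : Finset (Fin (circuitDomains.size h))), X ∈ F h ↔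
      f (decide (X ≠ ∅)) (decide ¬ X ⊆ vars h) (decide ((vars h \ X).card < h.2))
        (decide (h.2 < (vars h \ X).card)) (h.1.eval (absent X)) = true) :
    UniformPolyTimeOracle F := by
  refine ⟨8 * Polynomial.X * Polynomial.X + 60 * Polynomial.X + 61,
    (Oracle.oracle fun v => f v.seen v.pad v.lt v.gt v.a).computableWithin .inp .out
      Oracle.Reg.init ?_⟩
  rintro ⟨(h : Circuit × ℕ), X⟩
  refine ⟨8 * circuitDomains.size h * circuitDomains.size h + 60 * circuitDomains.size h + 60, ?_,
    by simp⟩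
  set l := List.ofFn (fun i => decide (i ∈ X)) with hl
  have hlen : l.length = circuitDomains.size h := by simp [hl]
  have hn := numVars_add_lt_size h
  have hy : (l.take h.1.numVars).map not = List.ofFn (absent X) := by
    apply List.ext_getElem
    · simp [hlen]; omega
    · intro i h1 h2
      simp [hl, absent, varEmb]
  have hcount : (l.take h.1.numVars).countP not = (vars h \ X).card := by
    rw [vars_sdiff, Finset.card_map, ← countP_ofFn, ← hy, List.countP_map]
    rfl
  have hseen : l.any id = decide (X ≠ ∅) := by
    have := any_drop_ofFn (m := 0) (fun i => decide (i ∈ X))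
    rw [List.drop_zero, ← hl] at this
    rw [Bool.eq_iff_iff, this]
    simp [Finset.eq_empty_iff_forall_notMem]
  have hpad : (l.drop h.1.numVars).any id = decide (¬ X ⊆ vars h) := by
    rw [Bool.eq_iff_iff, any_drop_ofFn]
    rw [decide_eq_true_eq, Finset.not_subset]
    refine exists_congr fun i => ?_
    rw [mem_vars, not_lt, decide_eq_true_eq, and_comm]
  have h1 := Oracle.exec_oracle (fun v => f v.seen v.pad v.lt v.gt v.a) f (fun _ => rfl) h.1 h.2
    (absent X) (l.take h.1.numVars) (l.drop h.1.numVars) hy (circuitDomains.size h)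
    (by simp [circuitDomains]) (by
      rw [← List.length_append, List.take_append_drop, hlen])
  rw [List.take_append_drop, hcount, hseen, hpad] at h1
  classical
  rw [Bool.eq_iff_iff.2 ((hF h X).symm.trans (decide_eq_true_iff (p := X ∈ F h)).symm)] at h1
  exact h1

theorem uniformPolyTimeOracle_missingFamily : UniformPolyTimeOracle missingFamily := by
  refine uniformPolyTimeOracle_of_iff _ (fun seen _ lt _ _ => !seen || !lt) fun h X => ?_
  simp [missingFamily]

theorem uniformPolyTimeOracle_lockedFamily : UniformPolyTimeOracle lockedFamily := by
  refine uniformPolyTimeOracle_of_iff _ (fun _ pad lt gt a => !pad || (lt || (!lt && !gt && a)))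
    fun h X => ?_
  simp only [lockedFamily, Set.mem_ofPred_eq, Bool.or_eq_true, Bool.not_eq_true', Bool.and_eq_true,
    decide_eq_true_eq, decide_eq_false_iff_not, not_not, not_lt]
  refine or_congr Iff.rfl (or_congr Iff.rfl (and_congr ?_ Iff.rfl))
  omega

theorem mainTheorem5 :
    ∃ (D : IndexedDomains) (F G : SetSystemFamily D),
      D.PolyTime ∧
      (∀ h, IsMatroid (F h)) ∧ (∀ h, IsGreedoid (G h)) ∧
      UniformPolyTimeOracle F ∧ UniformPolyTimeOracle G ∧
      WPHard (dualIntersectionProblem F G) := by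
  refine ⟨circuitDomains, missingFamily, lockedFamily, polyTime_circuitDomains,
    isMatroid_missingFamily, isGreedoid_lockedFamily, uniformPolyTimeOracle_missingFamily,
    uniformPolyTimeOracle_lockedFamily, fun L hL => ?_⟩
  exact ParamProblem.ReducesTo.trans_appendParam hL (fun p => p) (fun _ => rfl)
    mem_weightedCircuitSat_iff
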